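/- **Setting.** Let $k\ge 0$, let the states be vectors in $\mathbb R^m$ and the observations at time $i$ vectors in $\mathbb R^{d_i}$. For $i=1,\dots,k$ let $\mathcal M_i:\mathbb R^m\to\mathbb R^m$ and $\mathcal H_i:\mathbb R^m\to\mathbb R^{d_i}$ be continuously differentiable, and suppose that there are $\kappa>0$ and $s\ge 0$ such that $|\mathcal M_i(x)|$, $|\mathcal M_i'(x)|$, $|\mathcal H_i(x)|$, $|\mathcal H_i'(x)|$ are all at most $\kappa(1+|x|^s)$ for all $i$ and $x$ (Euclidean norms for vectors, spectral norms for matrices). Let $\mu_i\in\mathbb R^m$, $y_i\in\mathbb R^{d_i}$, $x_{\mathrm b}\in\mathbb R^m$, an initial approximation $x^0_{0:k}=(x^0_0,\dots,x^0_k)$ with entries in $\mathbb R^m$, and $\gamma>0$ be given, let $B$, $Q_i$ be symmetric positive semidefinite $m\times m$ matrices, and let $R_i$ be symmetric positive definite $d_i\times d_i$ matrices. (The vector $x_{\mathrm b}$ is arbitrary; $x_{\mathrm b}=x^0_0$ is allowed.) Put $\tilde{\mathcal H}_i(x)=\begin{bmatrix}\mathcal H_i(x)\\ x\end{bmatrix}$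 and $\tilde R_i=\begin{bmatrix}R_i&0\\0&\frac1\gamma I_m\end{bmatrix}$. **Perturbations.** For $j,n\ge1$ and $i=1,\dots,k$ let $X^{j,n}_{0|0}\sim N(x_{\mathrm b},B)$, $V^{j,n}_i\sim N(0,Q_i)$ and $\tilde W^{j,n}_i\sim N(0,\tilde R_i)$ be random vectors on one probability space such that, for each $j$, all those with upper index $j$ are mutually independent. They do not depend on the ensemble sizes. **Algorithm LM-EnKS with tangent operators.** Set $\tilde x^0=X^{0,n}_{0:k|k}=x^0_{0:k}$. For $j=1,2,\dots$, with ensemble size $N_j$ and $z=\tilde x^{j-1}$, start from $X^{j,n}_{0|0}$, $n=1,\dots,N_j$, and for $i=1,\dots,k$ do the following. Forecast: $$X^{j,n}_{i|i-1}=\mathcal M_i'(z_{i-1})\bigl(X^{j,n}_{i-1|i-1}-z_{i-1}\bigr)+\mathcal M_i(z_{i-1})+\mu_i+V^{j,n}_i .$$ Let $X^{j,n}_{0:i|i-1}$ be the composite of $X^{j,n}_{0:i-1|i-1}$ and $X^{j,n}_{i|i-1}$. Analysis: $$X^{j,n}_{0:i|i}=X^{j,n}_{0:i|i-1}+P\tilde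 H^{\mathrm T}\bigl(\tilde HP\tilde H^{\mathrm T}+\tilde R_i\bigr)^{-1}\Bigl(\begin{bmatrix}y_i\\ z_i\end{bmatrix}-\tilde W^{j,n}_i-\tilde{\mathcal H}_i(z_i)-\tilde{\mathcal H}_i'(z_i)\bigl(X^{j,n}_{i|i-1}-z_i\bigr)\Bigr),$$ where $\tilde H=[0,\dots,0,\tilde{\mathcal H}_i'(z_i)]$ and $P$ is the sample covariance (normalized by $1/(N_j-1)$) of $X^{j,1}_{0:i|i-1},\dots,X^{j,N_j}_{0:i|i-1}$. The next iterate is the sample mean $\tilde x^j=\bar X^{j,N_j}_{0:k|k}=\frac1{N_j}\sum_{n=1}^{N_j}X^{j,n}_{0:k|k}$. Write $X^{j,n,N_j}_{0:k|k}$ for the resulting members $X^{j,n}_{0:k|k}$. **Reference ensemble.** Set $U^{0,n}_{0:k|k}=x^0_{0:k}$. For $j\ge1$ the members $U^{j,n}$ are built by the same formulas from the same perturbations, starting from $U^{j,n}_{0|0}=X^{j,n}_{0|0}$, but with $z=E(U^{j-1,1}_{0:k|k})$ and with $P$ replaced by the exact covariance matrix of $U^{j,1}_{0:i|i-1}$.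 **Theorem.** For every $j\ge0$ and every $1\le p<\infty$, as $\min\{N_1,\dots,N_j\}\to\infty$, $$X^{j,n,N_j}_{0:k|k}\to U^{j,n}_{0:k|k}\ \text{ in }L^p\text{ for every fixed } n\ge 1\ (\text{so that } n\le N_j \text{ eventually}),\qquad \bar X^{j,N_j}_{0:k|k}\to E\bigl(U^{j,1}_{0:k|k}\bigr)\ \text{ in }L^p .$$ -/

import Mathlib

open MeasureTheory ProbabilityTheory Filter Topology Matrix
open scoped ENNReal

noncomputable section

namespace LMEnKS

/-- The state space `ℝ^m` with the Euclidean norm. -/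
abbrev State (m : ℕ) := EuclideanSpace ℝ (Fin m)

/-- The space of augmented observations `[y; x]` with `y ∈ ℝ^d` and `x ∈ ℝ^m`. -/
abbrev AugObs (d m : ℕ) := EuclideanSpace ℝ (Fin d ⊕ Fin m)

/-- The block vector `[y; x]`. -/
def blockVec {d m : ℕ} (y : EuclideanSpace ℝ (Fin d)) (x : State m) : AugObs d m :=
  WithLp.toLp 2 (Sum.elim (fun a => y a) (fun b => x b))

/-- The data of a weak-constraint 4DVAR problem, treated by Levenberg-Marquardt iterations.
Times are natural numbers; `M i`, `H i`, `μ i`, `y i`, `Q i`, `R i` are used for `1 ≤ i ≤ k` only,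
and `x0 i` for `0 ≤ i ≤ k` only. -/
structure Problem (m : ℕ) (d : ℕ → ℕ) where
  /-- the number of time steps -/
  k : ℕ
  /-- the model operators -/
  M : ℕ → State m → State m
  /-- the observation operators -/
  H : (i : ℕ) → State m → EuclideanSpace ℝ (Fin (d i))
  /-- the deterministic model forcing -/
  μ : ℕ → State m
  /-- the observed data -/
  y : (i : ℕ) → EuclideanSpace ℝ (Fin (d i))
  /-- the mean of the initial ensembles -/
  xb : State m
  /-- the background covariance -/
  B : Matrix (Fin m) (Fin m) ℝ
  /-- the model error covariances -/
  Q : ℕ → Matrix (Fin m) (Fin m) ℝ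
  /-- the observation error covariances -/
  R : (i : ℕ) → Matrix (Fin (d i)) (Fin (d i)) ℝ
  /-- the penalty parameter -/
  γ : ℝ
  /-- the initial approximation of the composite state -/
  x0 : ℕ → State m

variable {m : ℕ} {d : ℕ → ℕ}

/-- `B` and `Q i` are covariance matrices, `R i` is a nonsingular covariance matrix, and the penalty
parameter is positive. -/
structure Problem.Admissible (D : Problem m d) : Prop where
  posSemidef_B : D.B.PosSemidef
  posSemidef_Q : ∀ i, 1 ≤ i → i ≤ D.k → (D.Q i).PosSemidef
  posDef_R : ∀ i, 1 ≤ i → i ≤ D.k → (D.R i).PosDef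
  gamma_pos : 0 < D.γ

/-- The operators are continuously differentiable, and they and their Jacobians have at most
polynomial growth at infinity. -/
structure Problem.PolynomialGrowth (D : Problem m d) : Prop where
  contDiff_M : ∀ i, 1 ≤ i → i ≤ D.k → ContDiff ℝ 1 (D.M i)
  contDiff_H : ∀ i, 1 ≤ i → i ≤ D.k → ContDiff ℝ 1 (D.H i)
  growth : ∃ κ : ℝ, 0 < κ ∧ ∃ s : ℝ, 0 ≤ s ∧ ∀ i, 1 ≤ i → i ≤ D.k → ∀ x : State m,
    ‖D.M i x‖ ≤ κ * (1 + ‖x‖ ^ s) ∧ ‖fderiv ℝ (D.M i) x‖ ≤ κ * (1 + ‖x‖ ^ s) ∧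
    ‖D.H i x‖ ≤ κ * (1 + ‖x‖ ^ s) ∧ ‖fderiv ℝ (D.H i) x‖ ≤ κ * (1 + ‖x‖ ^ s)

/-- The augmented observation operator `x ↦ [H_i(x); x]`. -/
def Problem.augH (D : Problem m d) (i : ℕ) (x : State m) : AugObs (d i) m :=
  blockVec (D.H i x) x

/-- The augmented observation error covariance `diag(R_i, (1/γ) I)`. -/
def Problem.augR (D : Problem m d) (i : ℕ) :
    Matrix (Fin (d i) ⊕ Fin m) (Fin (d i) ⊕ Fin m) ℝ :=
  Matrix.fromBlocks (D.R i) 0 0 ((1 / D.γ) • (1 : Matrix (Fin m) (Fin m) ℝ))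

/-- The Jacobian matrix at `x` of the augmented observation operator. -/
def Problem.jacH (D : Problem m d) (i : ℕ) (x : State m) :
    Matrix (Fin (d i) ⊕ Fin m) (Fin m) ℝ :=
  Matrix.of fun a b => fderiv ℝ (D.augH i) x (EuclideanSpace.single b 1) a

/-! A composite state `x_{0:i}` is stored as a sequence `ℕ → State m` whose entries after time `i`
are zero. -/

/-- The initial composite state `x_{0:0}`. -/
def initial (x : State m) : ℕ → State m := Pi.single 0 x

/-- The forecast step from time `i` to time `i + 1`: `x` is a composite state at time `i`, `v` is the
model perturbation, and the model is linearized at `z i`. -/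
def Problem.forecast (D : Problem m d) (z : ℕ → State m) (i : ℕ) (x : ℕ → State m)
    (v : State m) : ℕ → State m :=
  Function.update x (i + 1)
    (fderiv ℝ (D.M (i + 1)) (z i) (x i - z i) + D.M (i + 1) (z i) + D.μ (i + 1) + v)

/-- The block row for time `l` of the Kalman gain at time `i`. Here `C l` is the covariance between
the states at times `l` and `i`, and the observation operator is linearized at `z i`. The covariance
of the composite state times the transpose of `[0, …, 0, J]` has the block rows `C l * Jᵀ`. -/
def Problem.gain (D : Problem m d) (z : ℕ → State m) (i : ℕ)
    (C : ℕ → Matrix (Fin m) (Fin m) ℝ) (l : ℕ) : Matrix (Fin m) (Fin (d i) ⊕ Fin m) ℝ :=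
  C l * (D.jacH i (z i))ᵀ * (D.jacH i (z i) * C i * (D.jacH i (z i))ᵀ + D.augR i)⁻¹

/-- The perturbed innovation at time `i`, with the augmented data `[y_i; z_i]` and the
observation perturbation `w`. -/
def Problem.innovation (D : Problem m d) (z : ℕ → State m) (i : ℕ) (x : State m)
    (w : AugObs (d i) m) : AugObs (d i) m :=
  blockVec (D.y i) (z i) - w - D.augH i (z i) - fderiv ℝ (D.augH i) (z i) (x - z i)

/-- The analysis step at time `i`, applied to a composite forecast `x`. -/
def Problem.analysis (D : Problem m d) (z : ℕ → State m) (i : ℕ)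
    (C : ℕ → Matrix (Fin m) (Fin m) ℝ) (x : ℕ → State m) (w : AugObs (d i) m) :
    ℕ → State m :=
  fun l => x l + WithLp.toLp 2 (D.gain z i C l *ᵥ (D.innovation z i (x i) w).ofLp)

/-- The sample mean of the members `0, …, N - 1` of an ensemble. -/
def sampleMean {V : Type*} [AddCommGroup V] [Module ℝ V] (N : ℕ) (x : ℕ → V) : V :=
  (1 / (N : ℝ)) • ∑ n ∈ Finset.range N, x n

/-- The block for the times `l`, `i` of the sample covariance of the members `0, …, N - 1` of an
ensemble of composite states (`x n l` is the state of member `n` at time `l`). -/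
def sampleCov (N : ℕ) (x : ℕ → ℕ → State m) (i l : ℕ) : Matrix (Fin m) (Fin m) ℝ :=
  (1 / ((N : ℝ) - 1)) • ∑ n ∈ Finset.range N,
    Matrix.vecMulVec (x n l - sampleMean N x l).ofLp (x n i - sampleMean N x i).ofLp

/-- The ensemble of composite states at time `i` that the EnKS computes (analysis ensemble), as a
function of the linearization points `z`, the initial ensemble `a`, the model perturbations `v i n`
and the observation perturbations `w i n`; `N` is the ensemble size, the members are
`n = 0, …, N - 1`. -/
def Problem.enks (D : Problem m d) (N : ℕ) (z : ℕ → State m) (a : ℕ → State m)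
    (v : ℕ → ℕ → State m) (w : (i : ℕ) → ℕ → AugObs (d i) m) : ℕ → ℕ → ℕ → State m
  | 0 => fun n => initial (a n)
  | i + 1 =>
    let f : ℕ → ℕ → State m := fun n => D.forecast z i (D.enks N z a v w i n) (v (i + 1) n)
    fun n => D.analysis z (i + 1) (sampleCov N f (i + 1)) (f n) (w (i + 1) n)

variable {Ω : Type*} [MeasurableSpace Ω]

/-- The random perturbations: in LM iteration `j = 1, 2, …`, member `n` has the initial state
`init j n`, the model perturbation `model j i n` and the observation perturbation `obs j i n` at the
times `i`. They do not depend on the ensemble size. -/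
structure Perturbations (Ω : Type*) (m : ℕ) (d : ℕ → ℕ) where
  init : ℕ → ℕ → Ω → State m
  model : ℕ → ℕ → ℕ → Ω → State m
  obs : ℕ → (i : ℕ) → ℕ → Ω → AugObs (d i) m

/-- The labels of the perturbations in one LM iteration with times `1, …, k`. -/
inductive PertIndex (k : ℕ) where
  | init (n : ℕ)
  | model (i : Set.Icc 1 k) (n : ℕ)
  | obs (i : Set.Icc 1 k) (n : ℕ)

/-- The σ-algebra generated by one perturbation. -/
@[reducible] def Perturbations.sigma (ξ : Perturbations Ω m d) (j k : ℕ) : PertIndex k → MeasurableSpace Ω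
  | .init n => MeasurableSpace.comap (ξ.init j n) inferInstance
  | .model i n => MeasurableSpace.comap (ξ.model j i n) inferInstance
  | .obs i n => MeasurableSpace.comap (ξ.obs j i n) inferInstance

/-- The perturbations are random vectors with the prescribed Gaussian laws, and those of one LM
iteration are mutually independent. -/
structure Perturbations.IsSampleOf (ξ : Perturbations Ω m d) (D : Problem m d)
    (P : Measure Ω) : Prop where
  measurable_init : ∀ j, 1 ≤ j → ∀ n, Measurable (ξ.init j n)
  measurable_model : ∀ j, 1 ≤ j → ∀ i, 1 ≤ i → i ≤ D.k → ∀ n, Measurable (ξ.model j i n)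
  measurable_obs : ∀ j, 1 ≤ j → ∀ i, 1 ≤ i → i ≤ D.k → ∀ n, Measurable (ξ.obs j i n)
  law_init : ∀ j, 1 ≤ j → ∀ n, HasLaw (ξ.init j n) (multivariateGaussian D.xb D.B) P
  law_model : ∀ j, 1 ≤ j → ∀ i, 1 ≤ i → i ≤ D.k → ∀ n,
    HasLaw (ξ.model j i n) (multivariateGaussian 0 (D.Q i)) P
  law_obs : ∀ j, 1 ≤ j → ∀ i, 1 ≤ i → i ≤ D.k → ∀ n,
    HasLaw (ξ.obs j i n) (multivariateGaussian 0 (D.augR i)) P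
  indep : ∀ j, 1 ≤ j → iIndep (ξ.sigma j D.k) P

/-- One LM iteration of LM-EnKS: the analysis ensemble at the final time `k` in iteration `j`, with
ensemble size `N`, linearized at the sequence of states `z`, for the outcome `ω`. -/
def Problem.lmStep (D : Problem m d) (ξ : Perturbations Ω m d) (j N : ℕ) (z : ℕ → State m)
    (ω : Ω) : ℕ → ℕ → State m :=
  D.enks N z (fun n => ξ.init j n ω) (fun i n => ξ.model j i n ω) (fun i n => ξ.obs j i n ω) D.k

/-- The iterates of LM-EnKS with ensemble sizes `N 1, N 2, …`: the initial approximation for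
`j = 0`, and the sample mean of the final ensemble of iteration `j` for `j ≥ 1`. -/
def Problem.iterate (D : Problem m d) (ξ : Perturbations Ω m d) (N : ℕ → ℕ) :
    ℕ → Ω → ℕ → State m
  | 0 => fun _ => D.x0
  | j + 1 => fun ω => sampleMean (N (j + 1))
      (D.lmStep ξ (j + 1) (N (j + 1)) (D.iterate ξ N j ω) ω)

/-- The member `n` of the final ensemble of iteration `j` of LM-EnKS with ensemble sizes
`N 1, N 2, …`. For `j = 0` it is the initial approximation. -/
def Problem.member (D : Problem m d) (ξ : Perturbations Ω m d) (N : ℕ → ℕ) :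
    ℕ → ℕ → Ω → ℕ → State m
  | 0, _ => fun _ => D.x0
  | j + 1, n => fun ω => D.lmStep ξ (j + 1) (N (j + 1)) (D.iterate ξ N j ω) ω n

/-- The cross covariance matrix `E[(X - E X) (Y - E Y)ᵀ]`. -/
def crossCov (P : Measure Ω) (X Y : Ω → State m) : Matrix (Fin m) (Fin m) ℝ :=
  Matrix.of fun a b => cov[fun ω => X ω a, fun ω => Y ω b; P]

/-- The reference ensemble of composite states at time `i` in one LM iteration: the exact covariance
of the forecast of the first member stands in place of the sample covariance. The first member has
the number `0`. -/
def Problem.refEnks (D : Problem m d) (P : Measure Ω) (z : ℕ → State m) (a : ℕ → Ω → State m)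
    (v : ℕ → ℕ → Ω → State m) (w : (i : ℕ) → ℕ → Ω → AugObs (d i) m) :
    ℕ → ℕ → Ω → ℕ → State m
  | 0 => fun n ω => initial (a n ω)
  | i + 1 =>
    let f : ℕ → Ω → ℕ → State m :=
      fun n ω => D.forecast z i (D.refEnks P z a v w i n ω) (v (i + 1) n ω)
    fun n ω => D.analysis z (i + 1)
      (fun l => crossCov P (fun ω' => f 0 ω' l) (fun ω' => f 0 ω' (i + 1)))
      (f n ω) (w (i + 1) n ω)

/-- The member `n` of the final reference ensemble of iteration `j`. It uses the perturbations of
LM-EnKS, and for `j ≥ 1` it is linearized at the mean of the first reference member of iteration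
`j - 1`. For `j = 0` it is the initial approximation. -/
def Problem.refMember (D : Problem m d) (P : Measure Ω) (ξ : Perturbations Ω m d) :
    ℕ → ℕ → Ω → ℕ → State m
  | 0, _ => fun _ => D.x0
  | j + 1, n =>
    D.refEnks P (fun i => ∫ ω, D.refMember P ξ j 0 ω i ∂P)
      (ξ.init (j + 1)) (ξ.model (j + 1)) (ξ.obs (j + 1)) D.k n

/-- The composite state `x_{0:k}` as a vector with the Euclidean norm. -/
def composite (k : ℕ) (x : ℕ → State m) : PiLp 2 (fun _ : Fin (k + 1) => State m) :=
  WithLp.toLp 2 fun l => x l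

/-- The filter on sequences of ensemble sizes that expresses `min {N 1, …, N j} → ∞`. -/
def minSizesAtTop (j : ℕ) : Filter (ℕ → ℕ) :=
  ⨅ c : ℕ, 𝓟 {N | ∀ l, 1 ≤ l → l ≤ j → c ≤ N l}

/-- Convergence in `L^p`: the limit is in `L^p`, eventually so are the random elements, and the
norms of the differences tend to zero. -/
def TendstoLp {ι V : Type*} [NormedAddCommGroup V] (P : Measure Ω) (p : ℝ≥0∞) (F : Filter ι)
    (X : ι → Ω → V) (Y : Ω → V) : Prop :=
  MemLp Y p P ∧ (∀ᶠ a in F, MemLp (X a) p P) ∧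
    Tendsto (fun a => eLpNorm (fun ω => X a ω - Y ω) p P) F (𝓝 0)

end LMEnKS

end

/-! The reference members in one iteration are i.i.d.: their linearization points and covariances
are deterministic, so member `n` is a fixed measurable function of its own perturbations. The
computed members are coupled through the sample covariance and the random linearization points. Both
of these converge to the deterministic quantities of the reference ensemble, and a member depends on
its own state only affinely, so the coupling disappears in the limit.

Two choices make the induction close. All finite `p` are treated at once, because Hölder's
inequality doubles the exponent at each product and polynomial growth multiplies it. The estimates
are also uniform over all members `n`, which is meaningful beyond the ensemble size because every
`n` is updated with the same gain. Uniformity gives, by Minkowski, closeness of sample means to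
those of the i.i.d. ensemble, and the `L^p` law of large numbers finishes: `LpConv.sampleMean`,
`lpConv_sampleCov`.

The nonlinear ingredients act only on quantities with a constant limit. The operators and Jacobians
are continuous with polynomial growth (`LpConv.comp_continuousWithinAt`). The inverse in the gain is
bounded, since its argument dominates the positive definite `augR` (`LpConv.matrix_inv`). Everything
else is bilinear (`LpConv.bilin`).

`lpConv_enks` is the induction over time within an iteration. `lpConv_iterate_member` is the
induction over iterations: the new linearization points are sample means and so again have a
constant limit, hence nothing about the joint law of different iterations is needed. -/

namespace LMEnKS

/-! ### Calculus of convergence in all `L^p` -/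

/-- The families `X` and `Y` of random elements get close along the filter `G` in all `L^p` with
`p < ∞`, and `Y` is bounded in all these spaces. With `G = F ×ˢ ⊤`, this is convergence along `F`
that is uniform in the second index. -/
structure LpConv {Ω : Type*} [MeasurableSpace Ω] {ι V : Type*} [NormedAddCommGroup V]
    (P : Measure Ω) (G : Filter ι) (X Y : ι → Ω → V) : Prop where
  aesm_left : ∀ i, AEStronglyMeasurable (X i) P
  aesm_right : ∀ i, AEStronglyMeasurable (Y i) P
  bdd : ∀ p : ℝ≥0∞, 1 ≤ p → p ≠ ∞ → ∃ C : ℝ≥0∞, C ≠ ∞ ∧ ∀ i, eLpNorm (Y i) p P ≤ C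
  lim : ∀ p : ℝ≥0∞, 1 ≤ p → p ≠ ∞ →
    Tendsto (fun i => eLpNorm (fun ω => X i ω - Y i ω) p P) G (𝓝 0)

namespace LpConv

variable {Ω : Type*} [MeasurableSpace Ω] {P : Measure Ω} {ι κ : Type*} {G : Filter ι}
  {V W E : Type*} [NormedAddCommGroup V] [NormedAddCommGroup W] [NormedAddCommGroup E]

theorem refl {Y : ι → Ω → V} (hY : ∀ i, AEStronglyMeasurable (Y i) P)
    (hb : ∀ p : ℝ≥0∞, 1 ≤ p → p ≠ ∞ → ∃ C : ℝ≥0∞, C ≠ ∞ ∧ ∀ i, eLpNorm (Y i) p P ≤ C) :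
    LpConv P G Y Y :=
  ⟨hY, hY, hb, fun p _ _ => by simpa using tendsto_const_nhds⟩

theorem eLpNorm_const_bound [IsProbabilityMeasure P] (c : V) (p : ℝ≥0∞) (hp : 1 ≤ p) :
    eLpNorm (fun _ : Ω => c) p P = ‖c‖ₑ := by
  rw [eLpNorm_const c (by positivity) (IsProbabilityMeasure.ne_zero P)]
  simp

theorem const [IsProbabilityMeasure P] (c : V) :
    LpConv P G (fun _ _ => c) (fun _ _ => c) :=
  refl (fun _ => aestronglyMeasurable_const) fun p hp _ =>
    ⟨‖c‖ₑ, by simp, fun _ => (eLpNorm_const_bound c p hp).le⟩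

theorem comp_tendsto {G' : Filter κ} {X Y : ι → Ω → V} (h : LpConv P G X Y) {u : κ → ι}
    (hu : Tendsto u G' G) : LpConv P G' (fun i => X (u i)) (fun i => Y (u i)) :=
  ⟨fun _ => h.aesm_left _, fun _ => h.aesm_right _,
    fun p hp hp' => (h.bdd p hp hp').imp fun _ hC => ⟨hC.1, fun _ => hC.2 _⟩,
    fun p hp hp' => (h.lim p hp hp').comp hu⟩

theorem memLp_right {X Y : ι → Ω → V} (h : LpConv P G X Y) {p : ℝ≥0∞} (hp : 1 ≤ p)
    (hp' : p ≠ ∞) (i : ι) : MemLp (Y i) p P := by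
  obtain ⟨C, hC, hYC⟩ := h.bdd p hp hp'
  exact ⟨h.aesm_right i, (hYC i).trans_lt hC.lt_top⟩

theorem eventually_memLp_left {X Y : ι → Ω → V} (h : LpConv P G X Y) {p : ℝ≥0∞} (hp : 1 ≤ p)
    (hp' : p ≠ ∞) : ∀ᶠ i in G, MemLp (X i) p P := by
  filter_upwards [(h.lim p hp hp').eventually (gt_mem_nhds (zero_lt_one (α := ℝ≥0∞)))] with i hi
  have h1 : MemLp (fun ω => X i ω - Y i ω) p P :=
    ⟨(h.aesm_left i).sub (h.aesm_right i), hi.trans ENNReal.one_lt_top⟩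
  have h2 := h1.add (h.memLp_right hp hp' i)
  convert h2 using 1
  ext ω
  simp

theorem add {X Y X' Y' : ι → Ω → V} (h : LpConv P G X Y) (h' : LpConv P G X' Y') :
    LpConv P G (fun i ω => X i ω + X' i ω) (fun i ω => Y i ω + Y' i ω) := by
  refine ⟨fun i => (h.aesm_left i).add (h'.aesm_left i),
    fun i => (h.aesm_right i).add (h'.aesm_right i), fun p hp hp' => ?_, fun p hp hp' => ?_⟩
  · obtain ⟨C, hC, hYC⟩ := h.bdd p hp hp'
    obtain ⟨C', hC', hYC'⟩ := h'.bdd p hp hp'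
    exact ⟨C + C', by finiteness, fun i =>
      (eLpNorm_add_le (h.aesm_right i) (h'.aesm_right i) hp).trans (add_le_add (hYC i) (hYC' i))⟩
  · have := (h.lim p hp hp').add (h'.lim p hp hp')
    rw [add_zero] at this
    refine tendsto_of_tendsto_of_tendsto_of_le_of_le tendsto_const_nhds this
      (fun _ => zero_le) fun i => ?_
    have e : (fun ω => X i ω + X' i ω - (Y i ω + Y' i ω)) =
        (fun ω => X i ω - Y i ω) + fun ω => X' i ω - Y' i ω := by
      ext ω; simp only [Pi.add_apply]; abel
    simp only [e]
    exact eLpNorm_add_le ((h.aesm_left i).sub (h.aesm_right i))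
      ((h'.aesm_left i).sub (h'.aesm_right i)) hp

variable [NormedSpace ℝ V] [NormedSpace ℝ W] [NormedSpace ℝ E]

theorem eLpNorm_clm_le (L : V →L[ℝ] W) (f : Ω → V) (p : ℝ≥0∞) :
    eLpNorm (fun ω => L (f ω)) p P ≤ ‖L‖ₑ * eLpNorm f p P :=
  eLpNorm_le_nnreal_smul_eLpNorm_of_ae_le_mul (c := ‖L‖₊)
    (Eventually.of_forall fun ω => L.le_opNNNorm (f ω)) p

theorem clm {X Y : ι → Ω → V} (h : LpConv P G X Y) (L : V →L[ℝ] W) :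
    LpConv P G (fun i ω => L (X i ω)) (fun i ω => L (Y i ω)) := by
  refine ⟨fun i => L.continuous.comp_aestronglyMeasurable (h.aesm_left i),
    fun i => L.continuous.comp_aestronglyMeasurable (h.aesm_right i),
    fun p hp hp' => ?_, fun p hp hp' => ?_⟩
  · obtain ⟨C, hC, hYC⟩ := h.bdd p hp hp'
    exact ⟨‖L‖ₑ * C, by finiteness, fun i => (eLpNorm_clm_le L _ p).trans (by gcongr; exact hYC i)⟩
  · have := ENNReal.Tendsto.const_mul (a := ‖L‖ₑ) (h.lim p hp hp') (Or.inr (by finiteness))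
    rw [mul_zero] at this
    refine tendsto_of_tendsto_of_tendsto_of_le_of_le tendsto_const_nhds this
      (fun _ => zero_le) fun i => ?_
    simp only [← map_sub]
    exact eLpNorm_clm_le L _ p

theorem sub {X Y X' Y' : ι → Ω → V} (h : LpConv P G X Y) (h' : LpConv P G X' Y') :
    LpConv P G (fun i ω => X i ω - X' i ω) (fun i ω => Y i ω - Y' i ω) := by
  simpa [sub_eq_add_neg] using h.add (h'.clm (-ContinuousLinearMap.id ℝ V))

theorem eLpNorm_bilin_le (B : V →L[ℝ] W →L[ℝ] E) {f : Ω → V} {g : Ω → W}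
    (hf : AEStronglyMeasurable f P) (hg : AEStronglyMeasurable g P) (p : ℝ≥0∞) :
    eLpNorm (fun ω => B (f ω) (g ω)) p P ≤ ‖B‖ₑ * eLpNorm f (2 * p) P * eLpNorm g (2 * p) P := by
  have : (2 * p).HolderTriple (2 * p) p := ⟨by
    rw [ENNReal.mul_inv (by simp) (by simp), ← add_mul, ENNReal.inv_two_add_inv_two, one_mul]⟩
  exact eLpNorm_le_eLpNorm_mul_eLpNorm_of_nnnorm hf hg (fun x y => B x y) ‖B‖₊
    (Eventually.of_forall fun ω => B.le_opNorm₂ (f ω) (g ω))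

/-- With `δ`, `δ'` the two differences, the error is `B δ δ' + B δ Y' + B Y δ'`. Hölder in `L^(2p)`
bounds each term by a product in which one factor tends to zero and the others stay bounded. -/
theorem bilin {X Y : ι → Ω → V} {X' Y' : ι → Ω → W} (h : LpConv P G X Y)
    (h' : LpConv P G X' Y') (B : V →L[ℝ] W →L[ℝ] E) :
    LpConv P G (fun i ω => B (X i ω) (X' i ω)) (fun i ω => B (Y i ω) (Y' i ω)) := by
  have meas : ∀ {f : Ω → V} {g : Ω → W}, AEStronglyMeasurable f P → AEStronglyMeasurable g P →
      AEStronglyMeasurable (fun ω => B (f ω) (g ω)) P := fun hf hg =>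
    B.continuous₂.comp_aestronglyMeasurable₂ hf hg
  have dbl : ∀ {p : ℝ≥0∞}, 1 ≤ p → 1 ≤ 2 * p := fun hp => hp.trans (by
    rw [two_mul]; exact le_self_add)
  refine ⟨fun i => meas (h.aesm_left i) (h'.aesm_left i),
    fun i => meas (h.aesm_right i) (h'.aesm_right i), fun p hp hp' => ?_, fun p hp hp' => ?_⟩
  · obtain ⟨C, hC, hYC⟩ := h.bdd (2 * p) (dbl hp) (by finiteness)
    obtain ⟨C', hC', hYC'⟩ := h'.bdd (2 * p) (dbl hp) (by finiteness)
    refine ⟨‖B‖ₑ * C * C', by finiteness, fun i =>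
      (eLpNorm_bilin_le B (h.aesm_right i) (h'.aesm_right i) p).trans ?_⟩
    gcongr
    exacts [hYC i, hYC' i]
  · obtain ⟨C, hC, hYC⟩ := h.bdd (2 * p) (dbl hp) (by finiteness)
    obtain ⟨C', hC', hYC'⟩ := h'.bdd (2 * p) (dbl hp) (by finiteness)
    have l := h.lim (2 * p) (dbl hp) (by finiteness)
    have l' := h'.lim (2 * p) (dbl hp) (by finiteness)
    have t1 := ENNReal.Tendsto.mul (ENNReal.Tendsto.const_mul (a := ‖B‖ₑ) l
      (Or.inr (by finiteness))) (Or.inr (by simp)) l' (Or.inr (by simp))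
    have t2 := ENNReal.Tendsto.mul_const (b := C') (ENNReal.Tendsto.const_mul (a := ‖B‖ₑ) l
      (Or.inr (by finiteness))) (Or.inr hC')
    have t3 := ENNReal.Tendsto.const_mul (a := ‖B‖ₑ * C) l' (Or.inr (by finiteness))
    have t := (t1.add t2).add t3
    simp only [mul_zero, zero_mul, add_zero] at t
    refine tendsto_of_tendsto_of_tendsto_of_le_of_le tendsto_const_nhds t
      (fun _ => zero_le) fun i => ?_
    have m := (h.aesm_left i).sub (h.aesm_right i)
    have m' := (h'.aesm_left i).sub (h'.aesm_right i)
    have e : (fun ω => B (X i ω) (X' i ω) - B (Y i ω) (Y' i ω)) =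
        ((fun ω => B (X i ω - Y i ω) (X' i ω - Y' i ω)) + fun ω => B (X i ω - Y i ω) (Y' i ω)) +
        fun ω => B (Y i ω) (X' i ω - Y' i ω) := by
      ext ω
      simp only [Pi.add_apply, map_sub, _root_.sub_apply]
      abel
    simp only [e]
    refine (eLpNorm_add_le ((meas m m').add (meas m (h'.aesm_right i)))
      (meas (h.aesm_right i) m') hp).trans (add_le_add ((eLpNorm_add_le (meas m m')
      (meas m (h'.aesm_right i)) hp).trans (add_le_add (eLpNorm_bilin_le B m m' p) ?_)) ?_)
    · refine (eLpNorm_bilin_le B m (h'.aesm_right i) p).trans ?_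
      gcongr
      exacts [le_rfl, hYC' i]
    · refine (eLpNorm_bilin_le B (h.aesm_right i) m' p).trans ?_
      gcongr
      exacts [hYC i, le_rfl]

theorem smul_const_right {c : ι → ℝ} {c₀ : ℝ} (hc : Tendsto c G (𝓝 c₀))
    [IsProbabilityMeasure P] {X Y : ι → Ω → V} (h : LpConv P G X Y) :
    LpConv P G (fun i ω => c i • X i ω) (fun i ω => c₀ • Y i ω) := by
  have hc' : LpConv P G (fun i (_ : Ω) => c i) (fun _ _ => c₀) := by
    refine ⟨fun _ => aestronglyMeasurable_const, fun _ => aestronglyMeasurable_const,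
      (const (G := G) (P := P) c₀).bdd, fun p hp hp' => ?_⟩
    simp only [eLpNorm_const_bound _ p hp]
    simpa using (hc.sub_const c₀).enorm
  exact hc'.bilin h (ContinuousLinearMap.lsmul ℝ ℝ)

end LpConv

/-! ### Nonlinear functions of families with a constant limit -/

/-- A function with polynomial growth that is continuous at `c` differs from its value at `c` by
at most `ε` plus a multiple of a power of the distance from `c`. -/
theorem norm_sub_le_add_mul_pow {V W : Type*} [NormedAddCommGroup V] [NormedAddCommGroup W]
    {f : V → W} {T : Set V} {c : V} (hf : ContinuousWithinAt f T c) {K : ℝ} {r : ℕ}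
    (hg : ∀ x ∈ T, ‖f x‖ ≤ K * (1 + ‖x‖) ^ r) (hK : 0 ≤ K) {ε : ℝ} (hε : 0 < ε) :
    ∃ A : ℝ, 0 ≤ A ∧ ∀ x ∈ T, ‖f x - f c‖ ≤ ε + A * ‖x - c‖ ^ (r + 1) := by
  obtain ⟨δ, hδ, hfδ⟩ := Metric.continuousWithinAt_iff.1 hf ε hε
  -- Chosen so that `1 + ‖x‖ ≤ b * ‖x - c‖` as soon as `‖x - c‖ ≥ δ`.
  set b := (1 + ‖c‖) / δ + 1 with hb
  have hb0 : 0 ≤ b := by positivity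
  -- Away from `c` the two summands pay for `‖f x‖` and `‖f c‖`. The exponent is `r + 1` so that it
  -- is positive even when `f` is bounded.
  refine ⟨K * b ^ r / δ + ‖f c‖ / δ ^ (r + 1), by positivity, fun x hx => ?_⟩
  by_cases hxc : dist x c < δ
  · have := hfδ hx hxc
    rw [dist_eq_norm] at this
    have h2 : 0 ≤ (K * b ^ r / δ + ‖f c‖ / δ ^ (r + 1)) * ‖x - c‖ ^ (r + 1) := by positivity
    linarith
  · rw [dist_eq_norm, not_lt] at hxc
    have ht : 0 ≤ ‖x - c‖ := norm_nonneg _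
    have h1 : 1 ≤ ‖x - c‖ / δ := (one_le_div hδ).2 hxc
    have hx1 : 1 + ‖x‖ ≤ b * ‖x - c‖ := by
      have e1 : ‖x‖ ≤ ‖x - c‖ + ‖c‖ := by simpa using norm_add_le (x - c) c
      have e2 : (1 + ‖c‖) * 1 ≤ (1 + ‖c‖) * (‖x - c‖ / δ) := by gcongr
      have e3 : b * ‖x - c‖ = (1 + ‖c‖) * (‖x - c‖ / δ) + ‖x - c‖ := by rw [hb]; ring
      linarith
    have h3 : ‖f x‖ ≤ K * b ^ r / δ * ‖x - c‖ ^ (r + 1) := by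
      calc ‖f x‖ ≤ K * (1 + ‖x‖) ^ r := hg x hx
        _ ≤ K * (b * ‖x - c‖) ^ r := by gcongr
        _ = K * b ^ r * ‖x - c‖ ^ r * 1 := by rw [mul_pow]; ring
        _ ≤ K * b ^ r * ‖x - c‖ ^ r * (‖x - c‖ / δ) := by gcongr
        _ = _ := by rw [pow_succ]; ring
    have h4 : ‖f c‖ ≤ ‖f c‖ / δ ^ (r + 1) * ‖x - c‖ ^ (r + 1) := by
      calc ‖f c‖ = ‖f c‖ * 1 := (mul_one _).symm
        _ ≤ ‖f c‖ * (‖x - c‖ / δ) ^ (r + 1) := by gcongr; exact one_le_pow₀ h1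
        _ = _ := by rw [div_pow]; ring
    have := norm_sub_le (f x) (f c)
    rw [add_mul]
    linarith

theorem one_le_mul_ofReal_natCast_succ {p : ℝ≥0∞} (hp : 1 ≤ p) (r : ℕ) :
    1 ≤ p * ENNReal.ofReal ((r + 1 : ℕ) : ℝ) := by
  rw [ENNReal.ofReal_natCast]
  exact hp.trans (le_mul_of_one_le_right' (by norm_cast; lia))

namespace LpConv

variable {Ω : Type*} [MeasurableSpace Ω] {P : Measure Ω} [IsProbabilityMeasure P] {ι : Type*}
  {G : Filter ι} {V W : Type*} [NormedAddCommGroup V] [NormedAddCommGroup W]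

/-- Convergence to a constant is preserved by functions of polynomial growth that are continuous
at the constant. -/
theorem comp_continuousWithinAt {X : ι → Ω → V} {c : V} (h : LpConv P G X fun _ _ => c)
    {f : V → W} {T : Set V} (hf : ContinuousWithinAt f T c) {K : ℝ} {r : ℕ}
    (hg : ∀ x ∈ T, ‖f x‖ ≤ K * (1 + ‖x‖) ^ r) (hK : 0 ≤ K) (hT : ∀ i ω, X i ω ∈ T)
    (hm : ∀ i, AEStronglyMeasurable (fun ω => f (X i ω)) P) :
    LpConv P G (fun i ω => f (X i ω)) (fun _ _ => f c) := by
  refine ⟨hm, fun _ => aestronglyMeasurable_const, (const (G := G) (P := P) (f c)).bdd,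
    fun p hp hp' => ?_⟩
  rw [ENNReal.tendsto_nhds_zero]
  intro ε hε
  obtain ⟨η, hη0, hηε⟩ : ∃ η : ℝ, 0 < η ∧ ENNReal.ofReal η ≤ ε / 2 := by
    obtain ⟨y, hy0, hy⟩ := ENNReal.lt_iff_exists_nnreal_btwn.1 (ENNReal.half_pos hε.ne')
    refine ⟨y, by exact_mod_cast hy0, ?_⟩
    rw [ENNReal.ofReal_coe_nnreal]
    exact hy.le
  obtain ⟨A, hA0, hA⟩ := norm_sub_le_add_mul_pow hf hg hK hη0
  set q : ℝ := ((r + 1 : ℕ) : ℝ) with hq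
  have hq0 : 0 < q := by positivity
  -- The `L^p` norm of `‖X - c‖ ^ q` is the `q`-th power of the `L^(pq)` norm of `X - c`, so
  -- convergence in a higher `L^p` controls the error.
  have key : ∀ i, eLpNorm (fun ω => f (X i ω) - f c) p P ≤
      ε / 2 + ENNReal.ofReal A * eLpNorm (fun ω => X i ω - c) (p * ENNReal.ofReal q) P ^ q := by
    intro i
    have m : AEStronglyMeasurable (fun ω => ‖X i ω - c‖ ^ q) P := by
      have := ((h.aesm_left i).sub (h.aesm_right i)).norm
      exact (Real.continuous_rpow_const hq0.le).comp_aestronglyMeasurable this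
    calc eLpNorm (fun ω => f (X i ω) - f c) p P
        ≤ eLpNorm ((fun _ : Ω => η) + fun ω => A • ‖X i ω - c‖ ^ q) p P := by
          refine eLpNorm_mono_real fun ω => ?_
          simpa only [hq, Real.rpow_natCast, Pi.add_apply, smul_eq_mul] using hA (X i ω) (hT i ω)
      _ ≤ eLpNorm (fun _ : Ω => η) p P + eLpNorm (fun ω => A • ‖X i ω - c‖ ^ q) p P :=
          eLpNorm_add_le aestronglyMeasurable_const (m.const_smul A) hp
      _ ≤ _ := by
          refine add_le_add ?_ ?_
          · rw [eLpNorm_const_bound _ p hp, Real.enorm_eq_ofReal hη0.le]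
            exact hηε
          · have := eLpNorm_const_smul A (fun ω => ‖X i ω - c‖ ^ q) p P
            rw [eLpNorm_norm_rpow _ hq0, Real.enorm_eq_ofReal hA0] at this
            exact this.le
  have l := h.lim (p * ENNReal.ofReal q) (one_le_mul_ofReal_natCast_succ hp r) (by finiteness)
  have l2 := ENNReal.Tendsto.const_mul (a := ENNReal.ofReal A)
    ((ENNReal.continuous_rpow_const (y := q)).tendsto _ |>.comp l) (Or.inr (by finiteness))
  rw [ENNReal.zero_rpow_of_pos hq0, mul_zero, ENNReal.tendsto_nhds_zero] at l2
  filter_upwards [l2 (ε / 2) (ENNReal.half_pos hε.ne')] with i hi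
  calc _ ≤ _ := key i
    _ ≤ ε / 2 + ε / 2 := by gcongr; exact hi
    _ = ε := ENNReal.add_halves ε

end LpConv

/-! ### Sample means of uniformly close families -/

section SampleMean

variable {Ω : Type*} [MeasurableSpace Ω] {P : Measure Ω} {V : Type*} [NormedAddCommGroup V]
  [NormedSpace ℝ V]

theorem aestronglyMeasurable_sampleMean {Y : ℕ → Ω → V}
    (h : ∀ n, AEStronglyMeasurable (Y n) P) (N : ℕ) :
    AEStronglyMeasurable (fun ω => sampleMean N fun n => Y n ω) P :=
  (Finset.aestronglyMeasurable_fun_sum _ fun n _ => h n).const_smul (1 / (N : ℝ))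

theorem eLpNorm_sampleMean_le {Y : ℕ → Ω → V} (hY : ∀ n, AEStronglyMeasurable (Y n) P) {p : ℝ≥0∞}
    (hp : 1 ≤ p) {C : ℝ≥0∞} (hC : ∀ n, eLpNorm (Y n) p P ≤ C) (N : ℕ) :
    eLpNorm (fun ω => sampleMean N fun n => Y n ω) p P ≤ C := by
  have e : (fun ω => sampleMean N fun n => Y n ω) =
      (1 / (N : ℝ)) • ∑ n ∈ Finset.range N, Y n := by
    ext ω; simp [sampleMean]
  rw [e, eLpNorm_const_smul]
  rcases N.eq_zero_or_pos with rfl | hN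
  · simp
  have h1 : eLpNorm (∑ n ∈ Finset.range N, Y n) p P ≤ N * C := by
    refine (eLpNorm_sum_le (fun n _ => hY n) hp).trans ((Finset.sum_le_sum fun n _ => hC n).trans ?_)
    simp
  calc _ ≤ ‖1 / (N : ℝ)‖ₑ * (N * C) := by gcongr
    _ = C := by
      have hN' : (0 : ℝ) < N := by positivity
      rw [← mul_assoc, Real.enorm_eq_ofReal (by positivity), one_div,
        ENNReal.ofReal_inv_of_pos hN', ENNReal.ofReal_natCast,
        ENNReal.inv_mul_cancel (by simpa using hN.ne') (by simp), one_mul]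

/-- Sample means converge to `c` if they do so for a sequence of random elements that the members
approach uniformly. -/
theorem LpConv.sampleMean [IsProbabilityMeasure P] {α : Type*} {F : Filter α} {X : α → ℕ → Ω → V}
    {Y : ℕ → Ω → V} {c : V}
    (h : LpConv P (F ×ˢ (⊤ : Filter ℕ)) (fun q => X q.1 q.2) (fun q => Y q.2))
    (hY : ∀ p : ℝ≥0∞, 1 ≤ p → p ≠ ∞ → Tendsto
      (fun N => eLpNorm (fun ω => sampleMean N (fun n => Y n ω) - c) p P) atTop (𝓝 0))
    {N : α → ℕ} (hN : Tendsto N F atTop) :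
    LpConv P F (fun a ω => sampleMean (N a) (fun n => X a n ω)) (fun _ _ => c) := by
  have mX : ∀ a n, AEStronglyMeasurable (X a n) P := fun a n => h.aesm_left (a, n)
  refine ⟨fun a => aestronglyMeasurable_sampleMean (mX a) _, fun _ => aestronglyMeasurable_const,
    (LpConv.const (P := P) (G := F) c).bdd, fun p hp hp' => ?_⟩
  rcases isEmpty_or_nonempty α with hα | ⟨⟨a₀⟩⟩
  · rw [Subsingleton.elim F ⊥]; exact tendsto_bot
  have mY : ∀ n, AEStronglyMeasurable (Y n) P := fun n => h.aesm_right (a₀, n)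
  have l := h.lim p hp hp'
  rw [ENNReal.tendsto_nhds_zero] at l ⊢
  have l2 := (hY p hp hp').comp hN
  rw [ENNReal.tendsto_nhds_zero] at l2
  intro ε hε
  have hε2 := ENNReal.half_pos hε.ne'
  -- Along `F ×ˢ ⊤`, an eventual bound holds for all members simultaneously, which is what averaging
  -- over `N a` of them requires.
  filter_upwards [mem_prod_top.1 (l (ε / 2) hε2), l2 (ε / 2) hε2] with a h1 h2
  have e : (fun ω => LMEnKS.sampleMean (N a) (fun n => X a n ω) - c) =
      (fun ω => LMEnKS.sampleMean (N a) fun n => X a n ω - Y n ω) +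
      fun ω => LMEnKS.sampleMean (N a) (fun n => Y n ω) - c := by
    ext ω
    simp only [LMEnKS.sampleMean, Finset.sum_sub_distrib, smul_sub, Pi.add_apply]
    abel
  rw [e]
  refine (eLpNorm_add_le (aestronglyMeasurable_sampleMean (fun n => (mX a n).sub (mY n)) _)
    ((aestronglyMeasurable_sampleMean mY _).sub aestronglyMeasurable_const) hp).trans ?_
  rw [← ENNReal.add_halves ε]
  exact add_le_add (eLpNorm_sampleMean_le (fun n => (mX a n).sub (mY n)) hp h1 _) h2

end SampleMean


/-! ### Bilinear matrix operations and bounded inverses -/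

section Matrices

open scoped Matrix.Norms.L2Operator

/-- Matrix multiplication as a continuous bilinear map. -/
noncomputable def mulBilin (a b c : Type*) [Fintype a] [Fintype b] [Fintype c] [DecidableEq a]
    [DecidableEq b] [DecidableEq c] :
    Matrix a b ℝ →L[ℝ] Matrix b c ℝ →L[ℝ] Matrix a c ℝ :=
  (LinearMap.mk₂ ℝ (fun A B => A * B) Matrix.add_mul Matrix.smul_mul Matrix.mul_add
    fun c A B => Matrix.mul_smul A c B).toContinuousBilinearMap

/-- The action of matrices on Euclidean vectors as a continuous bilinear map. -/
noncomputable def mulVecBilin (a b : Type*) [Fintype a] [Fintype b] [DecidableEq a]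
    [DecidableEq b] :
    Matrix a b ℝ →L[ℝ] EuclideanSpace ℝ b →L[ℝ] EuclideanSpace ℝ a :=
  (LinearMap.mk₂ ℝ (fun (A : Matrix a b ℝ) (x : EuclideanSpace ℝ b) =>
      WithLp.toLp 2 (A *ᵥ x.ofLp))
    (fun A B x => by rw [Matrix.add_mulVec]; rfl)
    (fun c A x => by rw [Matrix.smul_mulVec]; rfl)
    (fun A x y => by rw [WithLp.ofLp_add, Matrix.mulVec_add]; rfl)
    (fun c A x => by rw [WithLp.ofLp_smul, Matrix.mulVec_smul]; rfl)).toContinuousBilinearMap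

/-- The outer product of Euclidean vectors as a continuous bilinear map. -/
noncomputable def outerBilin (a b : Type*) [Fintype a] [Fintype b] [DecidableEq a]
    [DecidableEq b] :
    EuclideanSpace ℝ a →L[ℝ] EuclideanSpace ℝ b →L[ℝ] Matrix a b ℝ :=
  (LinearMap.mk₂ ℝ (fun (x : EuclideanSpace ℝ a) (y : EuclideanSpace ℝ b) =>
      Matrix.vecMulVec x.ofLp y.ofLp)
    (fun _ _ _ => Matrix.add_vecMulVec _ _ _)
    (fun _ _ _ => Matrix.smul_vecMulVec _ _ _)
    (fun _ _ _ => Matrix.vecMulVec_add _ _ _)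
    (fun _ _ _ => Matrix.vecMulVec_smul _ _ _)).toContinuousBilinearMap

/-- Transposition as a continuous linear map. -/
noncomputable def transposeCLM (a b : Type*) [Fintype a] [Fintype b] [DecidableEq a]
    [DecidableEq b] : Matrix a b ℝ →L[ℝ] Matrix b a ℝ :=
  LinearMap.toContinuousLinearMap (Matrix.transposeLinearEquiv a b ℝ ℝ).toLinearMap

/-- The matrix of a continuous linear map between Euclidean spaces, as a continuous linear
function of the map. -/
noncomputable def matrixCLM (a b : Type*) [Fintype a] [Fintype b] [DecidableEq a]
    [DecidableEq b] : (EuclideanSpace ℝ b →L[ℝ] EuclideanSpace ℝ a) →L[ℝ] Matrix a b ℝ :=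
  LinearMap.toContinuousLinearMap
    { toFun := fun L => Matrix.of fun i j => L (EuclideanSpace.single j 1) i
      map_add' := fun _ _ => rfl
      map_smul' := fun _ _ => rfl }

variable {a : Type*} [Fintype a] [DecidableEq a]

/-- Positive definite matrices are coercive. -/
theorem exists_sq_norm_le_of_posDef {R : Matrix a a ℝ} (hR : R.PosDef) :
    ∃ K : ℝ, 0 ≤ K ∧ ∀ x : EuclideanSpace ℝ a, ‖x‖ ^ 2 ≤ K * (x.ofLp ⬝ᵥ R *ᵥ x.ofLp) := by
  open scoped MatrixOrder in
  -- Factor `R = star b * b` with `b` invertible: the quadratic form is `‖b x‖ ^ 2`, and `x` is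
  -- recovered through `b⁻¹`.
  obtain ⟨b, hb, hRb⟩ := CStarAlgebra.isStrictlyPositive_iff_eq_star_mul_self.1
    hR.isStrictlyPositive
  refine ⟨‖b⁻¹‖ ^ 2, by positivity, fun x => ?_⟩
  set y : EuclideanSpace ℝ a := WithLp.toLp 2 (b *ᵥ x.ofLp) with hy
  have h1 : x.ofLp ⬝ᵥ R *ᵥ x.ofLp = ‖y‖ ^ 2 := by
    rw [hRb, EuclideanSpace.real_norm_sq_eq, ← Matrix.mulVec_mulVec, Matrix.star_eq_conjTranspose,
      Matrix.conjTranspose_eq_transpose_of_trivial, Matrix.dotProduct_mulVec,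
      Matrix.vecMul_transpose]
    simp [hy, dotProduct, sq]
  have h2 : x = WithLp.toLp 2 (b⁻¹ *ᵥ y.ofLp) := by
    simp [hy, Matrix.mulVec_mulVec,
      Matrix.nonsing_inv_mul b ((Matrix.isUnit_iff_isUnit_det b).1 hb)]
  have h3 : ‖x‖ ≤ ‖b⁻¹‖ * ‖y‖ := by
    conv_lhs => rw [h2]
    exact Matrix.l2_opNorm_mulVec b⁻¹ y
  rw [h1, ← mul_pow]
  gcongr

/-- The inverses of the matrices above a positive definite matrix are bounded. -/
theorem exists_norm_inv_le {R : Matrix a a ℝ} (hR : R.PosDef) :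
    ∃ K : ℝ, 0 ≤ K ∧ ∀ S : Matrix a a ℝ, (S - R).PosSemidef → ‖S⁻¹‖ ≤ K := by
  obtain ⟨K, hK, h⟩ := exists_sq_norm_le_of_posDef hR
  refine ⟨K, hK, fun S hS => ?_⟩
  have hSu : IsUnit S := by
    have := hR.add_posSemidef hS
    rw [add_sub_cancel] at this
    exact this.isUnit
  rw [Matrix.cstar_norm_def]
  refine ContinuousLinearMap.opNorm_le_bound _ hK fun y => ?_
  set x := Matrix.toEuclideanCLM (n := a) (𝕜 := ℝ) S⁻¹ y with hx
  have hxo : x.ofLp = S⁻¹ *ᵥ y.ofLp := Matrix.ofLp_toEuclideanCLM _ _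
  have hSx : S *ᵥ x.ofLp = y.ofLp := by
    rw [hxo, Matrix.mulVec_mulVec,
      Matrix.mul_nonsing_inv S ((Matrix.isUnit_iff_isUnit_det S).1 hSu), Matrix.one_mulVec]
  -- For `x = S⁻¹ y`, the form of `R` is below that of `S`, which equals `x ⬝ᵥ y`. Coercivity of `R`
  -- and Cauchy-Schwarz then give `‖x‖ ^ 2 ≤ K * ‖x‖ * ‖y‖`.
  have h1 : x.ofLp ⬝ᵥ R *ᵥ x.ofLp ≤ x.ofLp ⬝ᵥ y.ofLp := by
    have := hS.dotProduct_mulVec_nonneg x.ofLp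
    rw [star_trivial, Matrix.sub_mulVec, dotProduct_sub, hSx] at this
    linarith
  have h2 : x.ofLp ⬝ᵥ y.ofLp ≤ ‖x‖ * ‖y‖ := by
    have := real_inner_le_norm x y
    rwa [PiLp.inner_apply, show (∑ i, inner ℝ (x i) (y i)) = x.ofLp ⬝ᵥ y.ofLp by
      simp [dotProduct, mul_comm]] at this
  have h3 : ‖x‖ ^ 2 ≤ K * (‖x‖ * ‖y‖) := (h x).trans (by gcongr; exact h1.trans h2)
  rcases (norm_nonneg x).eq_or_lt with h0 | h0
  · rw [← h0]; positivity
  · nlinarith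

theorem continuousAt_matrix_inv {S : Matrix a a ℝ} (hS : IsUnit S) :
    ContinuousAt (fun A : Matrix a a ℝ => A⁻¹) S := by
  have hd : S.det ≠ 0 := ((Matrix.isUnit_iff_isUnit_det S).1 hS).ne_zero
  have e : (fun A : Matrix a a ℝ => A⁻¹) = fun A => A.det⁻¹ • A.adjugate := by
    ext1 A; rw [Matrix.inv_def, Ring.inverse_eq_inv']
  rw [e]
  exact (continuous_id.matrix_det.continuousAt.inv₀ hd).smul
    continuous_id.matrix_adjugate.continuousAt

/-- By Cramer's rule; no invertibility is needed, because real inversion with `0⁻¹ = 0` is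
measurable everywhere. -/
theorem aestronglyMeasurable_matrix_inv {Ω : Type*} [MeasurableSpace Ω] {P : Measure Ω}
    {S : Ω → Matrix a a ℝ} (hS : AEStronglyMeasurable S P) :
    AEStronglyMeasurable (fun ω => (S ω)⁻¹) P := by
  have e : (fun ω => (S ω)⁻¹) = fun ω => (S ω).det⁻¹ • (S ω).adjugate := by
    ext1 ω; rw [Matrix.inv_def, Ring.inverse_eq_inv']
  rw [e]
  exact ((continuous_id.matrix_det.comp_aestronglyMeasurable hS).aemeasurable.inv
    ).aestronglyMeasurable.smul (continuous_id.matrix_adjugate.comp_aestronglyMeasurable hS)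

/-- On the set of matrices above `R` the inverse is bounded, that is, of growth degree `r = 0`, and
it is continuous at the invertible limit `S₀`. -/
theorem LpConv.matrix_inv {Ω : Type*} [MeasurableSpace Ω] {P : Measure Ω} [IsProbabilityMeasure P]
    {ι : Type*} {G : Filter ι} {S : ι → Ω → Matrix a a ℝ} {S₀ R : Matrix a a ℝ} (hR : R.PosDef)
    (hS : ∀ i ω, (S i ω - R).PosSemidef) (hS₀ : (S₀ - R).PosSemidef)
    (h : LpConv P G S fun _ _ => S₀) :
    LpConv P G (fun i ω => (S i ω)⁻¹) (fun _ _ => S₀⁻¹) := by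
  obtain ⟨K, hK, hb⟩ := exists_norm_inv_le hR
  have hu : IsUnit S₀ := by
    have := hR.add_posSemidef hS₀
    rw [add_sub_cancel] at this
    exact this.isUnit
  exact h.comp_continuousWithinAt (T := {A | (A - R).PosSemidef}) (r := 0)
    (continuousAt_matrix_inv hu).continuousWithinAt (fun A hA => by simpa using hb A hA) hK hS
    fun i => aestronglyMeasurable_matrix_inv (h.aesm_left i)

end Matrices

/-! ### Augmented observations and growth of the operators -/

variable {m : ℕ} {d : ℕ → ℕ}

theorem Problem.Admissible.posDef_augR {D : Problem m d} (hD : D.Admissible) {i : ℕ} (hi : 1 ≤ i)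
    (hik : i ≤ D.k) : (D.augR i).PosDef := by
  have hR := hD.posDef_R i hi hik
  have hγ : 0 < 1 / D.γ := one_div_pos.2 hD.gamma_pos
  refine Matrix.PosDef.of_dotProduct_mulVec_pos ?_ fun x hx => ?_
  · refine Matrix.IsHermitian.fromBlocks hR.1 (by simp) ?_
    exact (Matrix.PosDef.one.smul hγ).1
  · have e : star x ⬝ᵥ D.augR i *ᵥ x = star (x ∘ Sum.inl) ⬝ᵥ D.R i *ᵥ (x ∘ Sum.inl) +
        1 / D.γ * ((x ∘ Sum.inr) ⬝ᵥ (x ∘ Sum.inr)) := by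
      rw [Problem.augR, Matrix.fromBlocks_mulVec]
      simp [dotProduct, Fintype.sum_sum_type, Finset.mul_sum, Matrix.smul_mulVec, mul_left_comm]
    rw [e]
    have h0 : 0 ≤ (x ∘ Sum.inr) ⬝ᵥ (x ∘ Sum.inr) :=
      Finset.sum_nonneg fun b _ => mul_self_nonneg _
    -- The form splits into the two blocks, so strictness comes from `R` unless the first block
    -- vanishes; then it comes from `1 / γ`.
    by_cases hl : x ∘ Sum.inl = 0
    · have hr : (x ∘ Sum.inr) ⬝ᵥ (x ∘ Sum.inr) ≠ 0 := by
        intro h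
        rw [dotProduct_self_eq_zero] at h
        refine hx (funext fun b => ?_)
        rcases b with b | b
        exacts [congrFun hl b, congrFun h b]
      rw [hl]
      have := mul_pos hγ (h0.lt_of_ne' hr)
      simpa using this
    · have := hR.dotProduct_mulVec_pos hl
      have := mul_nonneg hγ.le h0
      linarith

/-- The block vector as a continuous linear map. -/
noncomputable def blockCLM (d m : ℕ) : EuclideanSpace ℝ (Fin d) × State m →L[ℝ] AugObs d m :=
  LinearMap.toContinuousLinearMap
    { toFun := fun q => blockVec q.1 q.2
      map_add' := fun q q' => by
        ext b; rcases b with b | b <;> simp [blockVec]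
      map_smul' := fun c q => by
        ext b; rcases b with b | b <;> simp [blockVec] }

theorem blockCLM_apply {d m : ℕ} (q : EuclideanSpace ℝ (Fin d) × State m) :
    blockCLM d m q = blockVec q.1 q.2 := rfl

theorem mul_one_add_rpow_le {κ s t : ℝ} (hκ : 0 ≤ κ) (hs : 0 ≤ s) (ht : 0 ≤ t) :
    κ * (1 + t ^ s) ≤ 2 * κ * (1 + t) ^ ⌈s⌉₊ := by
  have h1 : (1 : ℝ) ≤ (1 + t) ^ ⌈s⌉₊ := one_le_pow₀ (by linarith)
  have h2 : t ^ s ≤ (1 + t) ^ ⌈s⌉₊ := by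
    calc t ^ s ≤ (1 + t) ^ s := Real.rpow_le_rpow ht (by linarith) hs
      _ ≤ (1 + t) ^ (⌈s⌉₊ : ℝ) := Real.rpow_le_rpow_of_exponent_le (by linarith) (Nat.le_ceil s)
      _ = _ := Real.rpow_natCast _ _
  nlinarith

namespace Problem.PolynomialGrowth

variable {D : Problem m d} (h : D.PolynomialGrowth)
include h

theorem exists_pow_bound : ∃ K : ℝ, 0 ≤ K ∧ ∃ r : ℕ, ∀ i, 1 ≤ i → i ≤ D.k → ∀ x : State m,
    ‖D.M i x‖ ≤ K * (1 + ‖x‖) ^ r ∧ ‖fderiv ℝ (D.M i) x‖ ≤ K * (1 + ‖x‖) ^ r ∧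
    ‖D.H i x‖ ≤ K * (1 + ‖x‖) ^ r ∧ ‖fderiv ℝ (D.H i) x‖ ≤ K * (1 + ‖x‖) ^ r := by
  obtain ⟨κ, hκ, s, hs, hb⟩ := h.growth
  refine ⟨2 * κ, by positivity, ⌈s⌉₊, fun i hi hik x => ?_⟩
  have := mul_one_add_rpow_le hκ.le hs (norm_nonneg x)
  obtain ⟨h1, h2, h3, h4⟩ := hb i hi hik x
  exact ⟨h1.trans this, h2.trans this, h3.trans this, h4.trans this⟩

theorem contDiff_augH {i : ℕ} (hi : 1 ≤ i) (hik : i ≤ D.k) : ContDiff ℝ 1 (D.augH i) :=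
  (blockCLM (d i) m).contDiff.comp ((h.contDiff_H i hi hik).prodMk contDiff_id)

theorem fderiv_augH {i : ℕ} (hi : 1 ≤ i) (hik : i ≤ D.k) (x : State m) :
    fderiv ℝ (D.augH i) x =
      (blockCLM (d i) m).comp ((fderiv ℝ (D.H i) x).prod (ContinuousLinearMap.id ℝ _)) := by
  have h1 := ((h.contDiff_H i hi hik).differentiable one_ne_zero x).hasFDerivAt
  exact ((blockCLM (d i) m).hasFDerivAt.comp x (h1.prodMk (hasFDerivAt_id x))).fderiv

variable {Ω : Type*} [MeasurableSpace Ω] {P : Measure Ω} [IsProbabilityMeasure P] {ι : Type*}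
  {G : Filter ι} {X : ι → Ω → State m} {c : State m} (hX : LpConv P G X fun _ _ => c)
  {i : ℕ} (hi : 1 ≤ i) (hik : i ≤ D.k)
include hX hi hik

theorem lpConv_M : LpConv P G (fun a ω => D.M i (X a ω)) (fun _ _ => D.M i c) := by
  obtain ⟨K, hK, r, hb⟩ := h.exists_pow_bound
  have hc := (h.contDiff_M i hi hik).continuous
  exact hX.comp_continuousWithinAt (T := Set.univ) hc.continuousWithinAt
    (fun x _ => (hb i hi hik x).1) hK (fun _ _ => Set.mem_univ _)
    fun a => hc.comp_aestronglyMeasurable (hX.aesm_left a)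

theorem lpConv_fderiv_M :
    LpConv P G (fun a ω => fderiv ℝ (D.M i) (X a ω)) (fun _ _ => fderiv ℝ (D.M i) c) := by
  obtain ⟨K, hK, r, hb⟩ := h.exists_pow_bound
  have hc := (h.contDiff_M i hi hik).continuous_fderiv one_ne_zero
  exact hX.comp_continuousWithinAt (T := Set.univ) hc.continuousWithinAt
    (fun x _ => (hb i hi hik x).2.1) hK (fun _ _ => Set.mem_univ _)
    fun a => hc.comp_aestronglyMeasurable (hX.aesm_left a)

theorem lpConv_augH : LpConv P G (fun a ω => D.augH i (X a ω)) (fun _ _ => D.augH i c) := by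
  obtain ⟨K, hK, r, hb⟩ := h.exists_pow_bound
  have hc := (h.contDiff_augH hi hik).continuous
  -- The identity component of `augH` grows linearly, which costs one more power than `H` alone.
  refine hX.comp_continuousWithinAt (T := Set.univ) (K := ‖blockCLM (d i) m‖ * (K + 1))
    (r := r + 1) hc.continuousWithinAt (fun x _ => ?_) (by positivity) (fun _ _ => Set.mem_univ _)
    fun a => hc.comp_aestronglyMeasurable (hX.aesm_left a)
  have hx := norm_nonneg x
  have h1 : (1 : ℝ) ≤ (1 + ‖x‖) ^ r := one_le_pow₀ (by linarith)
  calc ‖D.augH i x‖ ≤ ‖blockCLM (d i) m‖ * ‖(D.H i x, x)‖ :=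
        (blockCLM (d i) m).le_opNorm (D.H i x, x)
    _ ≤ ‖blockCLM (d i) m‖ * ((K + 1) * (1 + ‖x‖) ^ (r + 1)) := by
        gcongr
        refine max_le ((hb i hi hik x).2.2.1.trans ?_) ?_
        · gcongr <;> linarith
        · change ‖x‖ ≤ _
          rw [pow_succ]
          nlinarith [mul_nonneg (mul_nonneg hK (zero_le_one.trans h1)) (by linarith : 0 ≤ 1 + ‖x‖)]
    _ = _ := by ring

theorem lpConv_fderiv_augH :
    LpConv P G (fun a ω => fderiv ℝ (D.augH i) (X a ω)) (fun _ _ => fderiv ℝ (D.augH i) c) := by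
  obtain ⟨K, hK, r, hb⟩ := h.exists_pow_bound
  have hc := (h.contDiff_augH hi hik).continuous_fderiv one_ne_zero
  refine hX.comp_continuousWithinAt (T := Set.univ) (K := ‖blockCLM (d i) m‖ * (K + 1))
    (r := r) hc.continuousWithinAt (fun x _ => ?_) (by positivity) (fun _ _ => Set.mem_univ _)
    fun a => hc.comp_aestronglyMeasurable (hX.aesm_left a)
  have h1 : (1 : ℝ) ≤ (1 + ‖x‖) ^ r := one_le_pow₀ (by linarith [norm_nonneg x])
  rw [h.fderiv_augH hi hik, mul_assoc]
  refine (ContinuousLinearMap.opNorm_comp_le _ _).trans ?_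
  gcongr
  rw [ContinuousLinearMap.opNorm_prod]
  refine max_le ((hb i hi hik x).2.2.2.trans ?_) ?_
  · gcongr; linarith
  · refine (ContinuousLinearMap.norm_id_le).trans ?_
    nlinarith [mul_nonneg hK (zero_le_one.trans h1)]

end Problem.PolynomialGrowth

/-! ### Stability of the forecast and analysis steps -/

section Steps

open scoped Matrix.Norms.L2Operator

variable {Ω : Type*} [MeasurableSpace Ω] {P : Measure Ω} [IsProbabilityMeasure P] {ι : Type*}
  {G : Filter ι} {D : Problem m d} {Z : ι → Ω → ℕ → State m} {z : ℕ → State m}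

/-- The Kalman gain depends continuously on the linearization points and the covariances. -/
theorem lpConv_gain (hD : D.Admissible) (hg : D.PolynomialGrowth)
    {C : ι → Ω → ℕ → Matrix (Fin m) (Fin m) ℝ} {C₀ : ℕ → Matrix (Fin m) (Fin m) ℝ} {i : ℕ}
    (hi : 1 ≤ i) (hik : i ≤ D.k) (hZ : LpConv P G (fun a ω => Z a ω i) (fun _ _ => z i))
    (hC : ∀ l, LpConv P G (fun a ω => C a ω l) (fun _ _ => C₀ l))
    (hpos : ∀ a ω, (C a ω i).PosSemidef) (hpos₀ : (C₀ i).PosSemidef) (l : ℕ) :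
    LpConv P G (fun a ω => D.gain (Z a ω) i (C a ω) l) (fun _ _ => D.gain z i C₀ l) := by
  have hJ : LpConv P G (fun a ω => D.jacH i (Z a ω i)) (fun _ _ => D.jacH i (z i)) :=
    (hg.lpConv_fderiv_augH hZ hi hik).clm (matrixCLM (Fin (d i) ⊕ Fin m) (Fin m))
  have hJt := hJ.clm (transposeCLM (Fin (d i) ⊕ Fin m) (Fin m))
  have hJC := hJ.bilin (hC i) (mulBilin (Fin (d i) ⊕ Fin m) (Fin m) (Fin m))
  have hJCJ := hJC.bilin hJt (mulBilin (Fin (d i) ⊕ Fin m) (Fin m) (Fin (d i) ⊕ Fin m))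
  have hS := hJCJ.add (LpConv.const (P := P) (G := G) (D.augR i))
  -- Positive semidefiniteness of the covariance keeps the matrix to be inverted above `augR`, for
  -- samples and limit alike.
  have psd : ∀ {J : Matrix (Fin (d i) ⊕ Fin m) (Fin m) ℝ} {A : Matrix (Fin m) (Fin m) ℝ},
      A.PosSemidef → (J * A * Jᵀ + D.augR i - D.augR i).PosSemidef := fun {J A} hA => by
    rw [add_sub_cancel_right, ← Matrix.conjTranspose_eq_transpose_of_trivial]
    exact hA.mul_mul_conjTranspose_same J
  have hSi := hS.matrix_inv (hD.posDef_augR hi hik) (fun a ω => psd (hpos a ω)) (psd hpos₀)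
  have hCJ := (hC l).bilin hJt (mulBilin (Fin m) (Fin m) (Fin (d i) ⊕ Fin m))
  exact hCJ.bilin hSi (mulBilin (Fin m) (Fin (d i) ⊕ Fin m) (Fin (d i) ⊕ Fin m))

/-- The state `X` has a random limit `Y`, but it enters affinely, so `bilin` suffices; only `Z`,
whose limit is constant, enters nonlinearly. -/
theorem lpConv_innovation (hg : D.PolynomialGrowth) {i : ℕ} (hi : 1 ≤ i) (hik : i ≤ D.k)
    (hZ : LpConv P G (fun a ω => Z a ω i) (fun _ _ => z i)) {X Y : ι → Ω → State m}
    (hX : LpConv P G X Y) {w : ι → Ω → AugObs (d i) m} (hw : LpConv P G w w) :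
    LpConv P G (fun a ω => D.innovation (Z a ω) i (X a ω) (w a ω))
      (fun a ω => D.innovation z i (Y a ω) (w a ω)) := by
  have h1 := ((hZ.clm (ContinuousLinearMap.inr ℝ (EuclideanSpace ℝ (Fin (d i))) (State m))).add
    (LpConv.const (D.y i, 0))).clm (blockCLM (d i) m)
  simp only [blockCLM_apply, ContinuousLinearMap.inr_apply, Prod.mk_add_mk, zero_add,
    add_zero] at h1
  exact ((h1.sub hw).sub (hg.lpConv_augH hZ hi hik)).sub
    ((hg.lpConv_fderiv_augH hZ hi hik).bilin (hX.sub hZ) (ContinuousLinearMap.id ℝ _))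

theorem lpConv_forecast (hg : D.PolynomialGrowth) {i : ℕ} (hik : i + 1 ≤ D.k)
    (hZ : LpConv P G (fun a ω => Z a ω i) (fun _ _ => z i)) {X Y : ι → Ω → ℕ → State m}
    (hX : ∀ l, LpConv P G (fun a ω => X a ω l) (fun a ω => Y a ω l)) {v : ι → Ω → State m}
    (hv : LpConv P G v v) (l : ℕ) :
    LpConv P G (fun a ω => D.forecast (Z a ω) i (X a ω) (v a ω) l)
      (fun a ω => D.forecast z i (Y a ω) (v a ω) l) := by
  by_cases hl : l = i + 1
  · subst hl
    simp only [Problem.forecast, Function.update_self]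
    exact ((((hg.lpConv_fderiv_M hZ (by lia) hik).bilin ((hX i).sub hZ)
      (ContinuousLinearMap.id ℝ _)).add (hg.lpConv_M hZ (by lia) hik)).add
      (LpConv.const _)).add hv
  · simp only [Problem.forecast, Function.update_of_ne hl]
    exact hX l

theorem lpConv_analysis (hg : D.PolynomialGrowth) {i : ℕ} (hi : 1 ≤ i) (hik : i ≤ D.k)
    {C : ι → Ω → ℕ → Matrix (Fin m) (Fin m) ℝ} {C₀ : ℕ → Matrix (Fin m) (Fin m) ℝ}
    (hZ : LpConv P G (fun a ω => Z a ω i) (fun _ _ => z i))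
    (hK : ∀ l, LpConv P G (fun a ω => D.gain (Z a ω) i (C a ω) l) (fun _ _ => D.gain z i C₀ l))
    {X Y : ι → Ω → ℕ → State m}
    (hX : ∀ l, LpConv P G (fun a ω => X a ω l) (fun a ω => Y a ω l))
    {w : ι → Ω → AugObs (d i) m} (hw : LpConv P G w w) (l : ℕ) :
    LpConv P G (fun a ω => D.analysis (Z a ω) i (C a ω) (X a ω) (w a ω) l)
      (fun a ω => D.analysis z i C₀ (Y a ω) (w a ω) l) :=
  (hX l).add ((hK l).bilin (lpConv_innovation hg hi hik hZ (hX i) hw)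
    (mulVecBilin (Fin m) (Fin (d i) ⊕ Fin m)))

end Steps


/-! ### Law of large numbers and sample covariances -/

/-- The random elements `U 0, U 1, …` are pairwise independent and identically distributed. -/
structure IsIID {Ω S : Type*} [MeasurableSpace Ω] [MeasurableSpace S] (P : Measure Ω)
    (U : ℕ → Ω → S) : Prop where
  indep : Pairwise fun n n' => IndepFun (U n) (U n') P
  ident : ∀ n, IdentDistrib (U n) (U 0) P P

section Covariance

variable {Ω : Type*} [MeasurableSpace Ω] {P : Measure Ω} {S : Type*} [MeasurableSpace S]

/-- The law of large numbers in `L^p` for measurable functions of independent identically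
distributed random elements. -/
theorem IsIID.tendsto_sampleMean {U : ℕ → Ω → S} (hU : IsIID P U) {V : Type*}
    [NormedAddCommGroup V] [NormedSpace ℝ V] [CompleteSpace V] [MeasurableSpace V] [BorelSpace V]
    {u : S → V} (hu : Measurable u) {p : ℝ≥0∞} (hp : 1 ≤ p) (hp' : p ≠ ∞)
    (hm : MemLp (fun ω => u (U 0 ω)) p P) :
    Tendsto (fun N => eLpNorm (fun ω => sampleMean N (fun n => u (U n ω)) -
      ∫ ω', u (U 0 ω') ∂P) p P) atTop (𝓝 0) := by
  have := strong_law_Lp hp hp' (fun n ω => u (U n ω)) hm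
    (fun n n' hn => (hU.indep hn).comp hu hu) (fun n => (hU.ident n).comp hu)
  simpa only [sampleMean, one_div] using this

variable {m : ℕ}

open scoped Matrix.Norms.L2Operator

theorem outerBilin_apply {a b : Type*} [Fintype a] [Fintype b] [DecidableEq a] [DecidableEq b]
    (x : EuclideanSpace ℝ a) (y : EuclideanSpace ℝ b) :
    outerBilin a b x y = Matrix.vecMulVec x.ofLp y.ofLp := rfl

theorem sum_range_eq_smul_sampleMean {V : Type*} [AddCommGroup V] [Module ℝ V] {N : ℕ}
    (hN : N ≠ 0) (x : ℕ → V) : ∑ n ∈ Finset.range N, x n = (N : ℝ) • sampleMean N x := by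
  rw [sampleMean, smul_smul, mul_one_div_cancel (by exact_mod_cast hN), one_smul]

theorem sum_bilin_sub_sampleMean {V W E : Type*} [NormedAddCommGroup V] [NormedAddCommGroup W]
    [NormedAddCommGroup E] [NormedSpace ℝ V] [NormedSpace ℝ W] [NormedSpace ℝ E]
    (B : V →L[ℝ] W →L[ℝ] E) (N : ℕ) (x : ℕ → V) (y : ℕ → W) :
    ∑ n ∈ Finset.range N, B (x n - sampleMean N x) (y n - sampleMean N y) =
      (N : ℝ) • (sampleMean N (fun n => B (x n) (y n)) - B (sampleMean N x) (sampleMean N y)) := by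
  rcases N.eq_zero_or_pos with rfl | hN
  · simp
  simp only [map_sub, _root_.sub_apply, Finset.sum_sub_distrib]
  rw [← map_sum, sum_range_eq_smul_sampleMean hN.ne' y,
    sum_range_eq_smul_sampleMean hN.ne' fun n => B (x n) (y n)]
  simp only [Finset.sum_const, Finset.card_range, ← Nat.cast_smul_eq_nsmul ℝ]
  have h2 : ∑ n ∈ Finset.range N, B (x n) (sampleMean N y) =
      (N : ℝ) • B (sampleMean N x) (sampleMean N y) := by
    have : ∑ n ∈ Finset.range N, B (x n) = (N : ℝ) • B (sampleMean N x) := by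
      rw [← map_sum, sum_range_eq_smul_sampleMean hN.ne' x, map_smul]
    rw [← _root_.sum_apply, this]; rfl
  rw [h2, map_smul, smul_sub]
  abel

/-- Mean of products minus product of means, with the correction `N / (N - 1)`: sample covariances
reduce to sample means. Division by zero makes it valid also for `N = 1`. -/
theorem sampleCov_eq (N : ℕ) (x : ℕ → ℕ → State m) (i l : ℕ) :
    sampleCov N x i l = ((N : ℝ) / (N - 1)) •
      (sampleMean N (fun n => outerBilin (Fin m) (Fin m) (x n l) (x n i)) -
        outerBilin (Fin m) (Fin m) (sampleMean N fun n => x n l) (sampleMean N fun n => x n i)) := by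
  have := sum_bilin_sub_sampleMean (outerBilin (Fin m) (Fin m)) N (fun n => x n l) fun n => x n i
  simp only [outerBilin_apply, WithLp.ofLp_sub] at this ⊢
  have e : ∀ t, sampleMean N x t = sampleMean N fun n => x n t := fun t => by simp [sampleMean]
  rw [sampleCov]
  simp only [e, this, WithLp.ofLp_sub]
  rw [smul_smul]
  congr 1
  ring

theorem posSemidef_sampleCov (N : ℕ) (x : ℕ → ℕ → State m) (i : ℕ) :
    (sampleCov N x i i).PosSemidef := by
  -- For `N = 0` the normalizing factor is `-1`, but the sum is empty.
  rcases N.eq_zero_or_pos with rfl | hN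
  · simpa [sampleCov] using Matrix.PosSemidef.zero
  · have h1 : (1 : ℝ) ≤ N := by exact_mod_cast hN
    refine Matrix.PosSemidef.smul (Matrix.posSemidef_sum _ fun n _ => ?_)
      (one_div_nonneg.2 (by linarith))
    simpa using Matrix.posSemidef_vecMulVec_self_star (x n i - sampleMean N x i).ofLp

variable [IsProbabilityMeasure P]

/-- The quadratic form at `x` is the variance of the scalar `∑ a, x a * X a`. -/
theorem posSemidef_crossCov {X : Ω → State m} (hX : MemLp X 2 P) :
    (crossCov P X X).PosSemidef := by
  have hXa : ∀ a, MemLp (fun ω => X ω a) 2 P := fun a =>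
    (EuclideanSpace.proj a : State m →L[ℝ] ℝ).comp_memLp' hX
  refine Matrix.PosSemidef.of_dotProduct_mulVec_nonneg ?_ fun x => ?_
  · ext a b
    simp [crossCov, covariance_comm]
  · have h := covariance_fun_sum_fun_sum (μ := P) (X := fun a ω => x a * X ω a)
      (Y := fun a ω => x a * X ω a) (fun a => (hXa a).const_mul _) fun a => (hXa a).const_mul _
    rw [covariance_self] at h
    · have e : star x ⬝ᵥ crossCov P X X *ᵥ x =
          ∑ a, ∑ b, cov[fun ω => x a * X ω a, fun ω => x b * X ω b; P] := by
        simp only [covariance_const_mul_left, covariance_const_mul_right, dotProduct,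
          Matrix.mulVec, crossCov, Matrix.of_apply, Finset.mul_sum, star_trivial]
        refine Finset.sum_congr rfl fun a _ => Finset.sum_congr rfl fun b _ => by ring
      rw [e, ← h]
      exact variance_nonneg _ _
    · exact (Finset.aemeasurable_fun_sum _ fun a _ =>
        ((hXa a).const_mul (x a)).aestronglyMeasurable.aemeasurable)

theorem crossCov_eq {X Y : Ω → State m} (hX : MemLp X 2 P) (hY : MemLp Y 2 P)
    (hXY : Integrable (fun ω => outerBilin (Fin m) (Fin m) (X ω) (Y ω)) P) :
    crossCov P X Y = ∫ ω, outerBilin (Fin m) (Fin m) (X ω) (Y ω) ∂P -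
      outerBilin (Fin m) (Fin m) (∫ ω, X ω ∂P) (∫ ω, Y ω ∂P) := by
  have comp : ∀ {Z : Ω → State m}, MemLp Z 2 P → ∀ a, MemLp (fun ω => Z ω a) 2 P := fun hZ a =>
    (EuclideanSpace.proj a : State m →L[ℝ] ℝ).comp_memLp' hZ
  have int : ∀ {Z : Ω → State m}, MemLp Z 2 P → ∀ a, (∫ ω, Z ω ∂P) a = ∫ ω, Z ω a ∂P :=
    fun hZ a => ((EuclideanSpace.proj a : State m →L[ℝ] ℝ).integral_comp_comm
      (hZ.integrable one_le_two)).symm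
  ext a b
  have h := (LinearMap.toContinuousLinearMap (Matrix.entryLinearMap ℝ ℝ a b)).integral_comp_comm hXY
  have h' : (∫ ω, outerBilin (Fin m) (Fin m) (X ω) (Y ω) ∂P) a b = ∫ ω, X ω a * Y ω b ∂P := h.symm
  rw [crossCov, Matrix.of_apply, covariance_eq_sub (comp hX a) (comp hY b), Matrix.sub_apply, h',
    outerBilin_apply, Matrix.vecMulVec_apply, int hX, int hY]
  rfl

theorem tendsto_natCast_div_sub_one :
    Tendsto (fun N : ℕ => (N : ℝ) / (N - 1)) atTop (𝓝 1) := by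
  simpa [sub_eq_add_neg] using tendsto_natCast_div_add_atTop (-1 : ℝ)

variable {α : Type*} {F : Filter α} {f : α → ℕ → Ω → ℕ → State m} {g : ℕ → Ω → ℕ → State m}
  {N : α → ℕ}

/-- The function `u` lets one i.i.d. ensemble of composite states serve for means of single states
and for means of outer products. -/
theorem lpConv_sampleMean_of_isIID (hg : IsIID P g) {V : Type*} [NormedAddCommGroup V]
    [NormedSpace ℝ V] [CompleteSpace V] {f : α → ℕ → Ω → V} {u : (ℕ → State m) → V}
    (hu : @Measurable _ _ _ (borel V) u)
    (hf : LpConv P (F ×ˢ (⊤ : Filter ℕ)) (fun q => f q.1 q.2) fun q ω => u (g q.2 ω))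
    (hN : Tendsto N F atTop) :
    LpConv P F (fun a ω => sampleMean (N a) fun n => f a n ω)
      (fun _ _ => ∫ ω, u (g 0 ω) ∂P) := by
  rcases isEmpty_or_nonempty α with hα | ⟨⟨a₀⟩⟩
  · exact ⟨fun a => isEmptyElim a, fun a => isEmptyElim a,
      fun p _ _ => ⟨0, by simp, fun a => isEmptyElim a⟩,
      fun p _ _ => by rw [Subsingleton.elim F ⊥]; exact tendsto_bot⟩
  let _ : MeasurableSpace V := borel V
  have : BorelSpace V := ⟨rfl⟩
  exact LpConv.sampleMean (Y := fun n ω => u (g n ω)) hf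
    (fun p hp hp' => hg.tendsto_sampleMean hu hp hp' (hf.memLp_right hp hp' (a₀, 0))) hN

/-- The sample covariances converge to the exact covariance of the limit ensemble. -/
theorem lpConv_sampleCov (hg : IsIID P g)
    (hf : ∀ l, LpConv P (F ×ˢ (⊤ : Filter ℕ)) (fun q ω => f q.1 q.2 ω l) fun q ω => g q.2 ω l)
    (hN : Tendsto N F atTop) (i l : ℕ) :
    LpConv P F (fun a ω => sampleCov (N a) (fun n => f a n ω) i l)
      (fun _ _ => crossCov P (fun ω => g 0 ω l) fun ω => g 0 ω i) := by
  rcases isEmpty_or_nonempty α with hα | ⟨⟨a₀⟩⟩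
  · exact ⟨fun a => isEmptyElim a, fun a => isEmptyElim a,
      fun p _ _ => ⟨0, by simp, fun a => isEmptyElim a⟩,
      fun p _ _ => by rw [Subsingleton.elim F ⊥]; exact tendsto_bot⟩
  have hmean : ∀ t, LpConv P F (fun a ω => sampleMean (N a) fun n => f a n ω t)
      (fun _ _ => ∫ ω, g 0 ω t ∂P) := fun t =>
    lpConv_sampleMean_of_isIID hg (f := fun a n ω => f a n ω t) (u := fun x => x t)
      (by rw [← BorelSpace.measurable_eq]; fun_prop) (hf t) hN
  have hprod := (hf l).bilin (hf i) (outerBilin (Fin m) (Fin m))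
  have hu : @Measurable _ _ _ (borel (Matrix (Fin m) (Fin m) ℝ))
      fun x : ℕ → State m => outerBilin (Fin m) (Fin m) (x l) (x i) := by
    let _ : MeasurableSpace (Matrix (Fin m) (Fin m) ℝ) := borel _
    have : BorelSpace (Matrix (Fin m) (Fin m) ℝ) := ⟨rfl⟩
    have h1 : Measurable fun x : ℕ → State m => (x l, x i) :=
      (measurable_pi_apply l).prodMk (measurable_pi_apply i)
    exact (outerBilin (Fin m) (Fin m)).continuous₂.measurable.comp h1
  have hmeanprod := lpConv_sampleMean_of_isIID hg
    (f := fun a n ω => outerBilin (Fin m) (Fin m) (f a n ω l) (f a n ω i))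
    (u := fun x => outerBilin (Fin m) (Fin m) (x l) (x i)) hu hprod hN
  have hcov := LpConv.smul_const_right (tendsto_natCast_div_sub_one.comp hN)
    (hmeanprod.sub ((hmean l).bilin (hmean i) (outerBilin (Fin m) (Fin m))))
  rw [crossCov_eq ((hf l).memLp_right one_le_two (by simp) (a₀, 0))
    ((hf i).memLp_right one_le_two (by simp) (a₀, 0))
    ((hprod.memLp_right le_rfl (by simp) (a₀, 0)).integrable le_rfl)]
  simpa only [sampleCov_eq, one_smul, Function.comp_apply] using hcov

end Covariance

/-! ### Independence and equal laws of the reference members -/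

section Reference

variable {m : ℕ} {d : ℕ → ℕ} {Ω : Type*} [MeasurableSpace Ω]

/-- The ensemble member that a perturbation belongs to. -/
def PertIndex.member {k : ℕ} : PertIndex k → ℕ
  | .init n => n
  | .model _ n => n
  | .obs _ n => n

/-- The position of a perturbation in the order in which the algorithm uses them. -/
def PertIndex.stage {k : ℕ} : PertIndex k → ℕ
  | .init _ => 0
  | .model i _ => 2 * i.1 - 1
  | .obs i _ => 2 * i.1

/-- The σ-algebra generated by the perturbations of member `n` up to stage `s`. -/
@[reducible] def Perturbations.past (ξ : Perturbations Ω m d) (j k s n : ℕ) : MeasurableSpace Ω :=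
  ⨆ x ∈ {x : PertIndex k | x.member = n ∧ x.stage ≤ s}, ξ.sigma j k x

theorem measurable_forecast (D : Problem m d) (z : ℕ → State m) (i : ℕ) :
    Measurable fun q : (ℕ → State m) × State m => D.forecast z i q.1 q.2 := by
  refine measurable_pi_lambda _ fun l => ?_
  by_cases hl : l = i + 1
  · subst hl
    simp only [Problem.forecast, Function.update_self]
    fun_prop
  · simp only [Problem.forecast, Function.update_of_ne hl]
    fun_prop

theorem measurable_analysis (D : Problem m d) (z : ℕ → State m) (i : ℕ)
    (C : ℕ → Matrix (Fin m) (Fin m) ℝ) :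
    Measurable fun q : (ℕ → State m) × AugObs (d i) m => D.analysis z i C q.1 q.2 := by
  refine measurable_pi_lambda _ fun l => ?_
  have h1 : Measurable fun q : (ℕ → State m) × AugObs (d i) m =>
      D.innovation z i (q.1 i) q.2 := by
    simp only [Problem.innovation]
    fun_prop
  have h2 : Measurable fun x : AugObs (d i) m =>
      mulVecBilin (Fin m) (Fin (d i) ⊕ Fin m) (D.gain z i C l) x := by fun_prop
  exact ((measurable_pi_apply l).comp measurable_fst).add (h2.comp h1)

theorem measurable_initial : Measurable (initial : State m → ℕ → State m) := by
  refine measurable_pi_lambda _ fun l => ?_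
  by_cases hl : l = 0
  · subst hl; simpa only [initial, Pi.single_eq_same] using measurable_id'
  · simp [initial, hl]

variable {P : Measure Ω} {D : Problem m d} {ξ : Perturbations Ω m d}

namespace Perturbations.IsSampleOf

variable (hξ : ξ.IsSampleOf D P) {j : ℕ} (hj : 1 ≤ j)
include hξ hj

theorem sigma_le (x : PertIndex D.k) : ξ.sigma j D.k x ≤ ‹MeasurableSpace Ω› := by
  rcases x with n | ⟨⟨i, hi, hik⟩, n⟩ | ⟨⟨i, hi, hik⟩, n⟩
  · exact (hξ.measurable_init j hj n).comap_le
  · exact (hξ.measurable_model j hj i hi hik n).comap_le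
  · exact (hξ.measurable_obs j hj i hi hik n).comap_le

theorem indepFun_of_disjoint {A B : Set (PertIndex D.k)} (hAB : Disjoint A B) {S T : Type*}
    [MeasurableSpace S] [MeasurableSpace T] {X : Ω → S} {Y : Ω → T}
    (hX : Measurable[⨆ x ∈ A, ξ.sigma j D.k x] X) (hY : Measurable[⨆ x ∈ B, ξ.sigma j D.k x] Y) :
    IndepFun X Y P := by
  rw [IndepFun_iff_Indep]
  exact indep_of_indep_of_le_right (indep_of_indep_of_le_left
    (indep_iSup_of_disjoint (hξ.sigma_le hj) (hξ.indep j hj) hAB) hX.comap_le) hY.comap_le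

/-- Different members use disjoint sets of perturbation labels, so grouping independent σ-algebras
gives independence. -/
theorem isIID_of_past {s : ℕ} {S : Type*} [MeasurableSpace S] {U : ℕ → Ω → S}
    (hU : ∀ n, Measurable[ξ.past j D.k s n] (U n)) (hid : ∀ n, IdentDistrib (U n) (U 0) P P) :
    IsIID P U :=
  ⟨fun n n' hn => hξ.indepFun_of_disjoint hj (Set.disjoint_left.2 fun _ hx hx' =>
    hn (hx.1.symm.trans hx'.1)) (hU n) (hU n'), hid⟩

/-- A measurable function of the past of a member and of its next perturbation is identically
distributed over the members. -/
theorem step [IsProbabilityMeasure P] {s : ℕ} {S T T' : Type*} [MeasurableSpace S]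
    [MeasurableSpace T] [MeasurableSpace T'] {U : ℕ → Ω → S} {V : ℕ → Ω → T} {u : S × T → T'}
    (hu : Measurable u) (x : ℕ → PertIndex D.k) (hxn : ∀ n, (x n).member = n)
    (hxs : ∀ n, (x n).stage = s + 1) (hV : ∀ n, ξ.sigma j D.k (x n) = MeasurableSpace.comap (V n) ‹_›)
    (hVid : ∀ n, IdentDistrib (V n) (V 0) P P)
    (hU : ∀ n, Measurable[ξ.past j D.k s n] (U n)) (hid : ∀ n, IdentDistrib (U n) (U 0) P P) :
    (∀ n, Measurable[ξ.past j D.k (s + 1) n] fun ω => u (U n ω, V n ω)) ∧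
      ∀ n, IdentDistrib (fun ω => u (U n ω, V n ω)) (fun ω => u (U 0 ω, V 0 ω)) P P := by
  have hVm : ∀ n, Measurable[⨆ y ∈ ({x n} : Set (PertIndex D.k)), ξ.sigma j D.k y] (V n) := by
    intro n
    rw [iSup_singleton, hV n]
    exact comap_measurable (V n)
  -- The new perturbation has stage `s + 1` and so is absent from the past up to `s`. Independence
  -- makes the law of the pair the product of the marginals, the same for every `n`.
  have hind : ∀ n, IndepFun (U n) (V n) P := fun n =>
    hξ.indepFun_of_disjoint hj (Set.disjoint_singleton_right.2 fun h => by
      have := h.2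
      rw [hxs n] at this
      lia) (hU n) (hVm n)
  refine ⟨fun n => ?_, fun n => ?_⟩
  · have h1 : Measurable[ξ.past j D.k (s + 1) n] (U n) :=
      (hU n).mono (biSup_mono fun y hy => ⟨hy.1, hy.2.trans (by lia)⟩) le_rfl
    have h2 : Measurable[ξ.past j D.k (s + 1) n] (V n) := by
      refine (hVm n).mono (biSup_mono fun y hy => ?_) le_rfl
      rw [Set.mem_singleton_iff.1 hy]
      exact ⟨hxn n, (hxs n).le⟩
    exact hu.comp (h1.prodMk h2)
  · exact ((hid n).prodMk (hVid n) (hind n) (hind 0)).comp hu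

variable [IsProbabilityMeasure P] (z : ℕ → State m)

/-- The exact covariance is deterministic and shared, so every member undergoes the same measurable
map of its past and its next perturbation. Measurability is carried along with the equality of laws
because it supplies the independence at the next step. -/
theorem refEnks_past (i : ℕ) (hik : i ≤ D.k) :
    (∀ n, Measurable[ξ.past j D.k (2 * i) n]
      (D.refEnks P z (ξ.init j) (ξ.model j) (ξ.obs j) i n)) ∧
    ∀ n, IdentDistrib (D.refEnks P z (ξ.init j) (ξ.model j) (ξ.obs j) i n)
      (D.refEnks P z (ξ.init j) (ξ.model j) (ξ.obs j) i 0) P P := by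
  induction i with
  | zero =>
    refine ⟨fun n => ?_, fun n => ?_⟩
    · have h : Measurable[ξ.past j D.k (2 * 0) n] (ξ.init j n) := by
        refine (comap_measurable (ξ.init j n)).mono ?_ le_rfl
        exact le_biSup (f := fun x => ξ.sigma j D.k x) (i := PertIndex.init n) ⟨rfl, le_rfl⟩
      exact measurable_initial.comp h
    · exact ((hξ.law_init j hj n).identDistrib (hξ.law_init j hj 0)).comp measurable_initial
  | succ i ih =>
    obtain ⟨h1, h2⟩ := ih (by lia)
    have hi : i + 1 ∈ Set.Icc 1 D.k := ⟨by lia, hik⟩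
    -- The forecast consumes stage `2 * (i + 1) - 1 = 2 * i + 1`, the analysis stage `2 * (i + 1)`.
    obtain ⟨h3, h4⟩ := hξ.step hj (measurable_forecast D z i)
      (fun n => PertIndex.model ⟨i + 1, hi⟩ n) (fun _ => rfl)
      (fun n => by simp only [PertIndex.stage]; lia) (V := ξ.model j (i + 1)) (fun _ => rfl)
      (fun n => (hξ.law_model j hj _ hi.1 hi.2 n).identDistrib (hξ.law_model j hj _ hi.1 hi.2 0))
      h1 h2
    exact hξ.step hj (measurable_analysis D z (i + 1) _)
      (fun n => PertIndex.obs ⟨i + 1, hi⟩ n) (fun _ => rfl)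
      (fun n => by simp only [PertIndex.stage]; lia) (V := ξ.obs j (i + 1)) (fun _ => rfl)
      (fun n => (hξ.law_obs j hj _ hi.1 hi.2 n).identDistrib (hξ.law_obs j hj _ hi.1 hi.2 0))
      h3 h4

theorem isIID_refEnks {i : ℕ} (hik : i ≤ D.k) :
    IsIID P (D.refEnks P z (ξ.init j) (ξ.model j) (ξ.obs j) i) :=
  hξ.isIID_of_past hj (hξ.refEnks_past hj z i hik).1 (hξ.refEnks_past hj z i hik).2

theorem isIID_forecast_refEnks {i : ℕ} (hik : i + 1 ≤ D.k) :
    IsIID P (fun n ω => D.forecast z i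
      (D.refEnks P z (ξ.init j) (ξ.model j) (ξ.obs j) i n ω) (ξ.model j (i + 1) n ω)) := by
  obtain ⟨h1, h2⟩ := hξ.refEnks_past hj z i (by lia)
  have hi : i + 1 ∈ Set.Icc 1 D.k := ⟨by lia, hik⟩
  obtain ⟨h3, h4⟩ := hξ.step hj (measurable_forecast D z i)
    (fun n => PertIndex.model ⟨i + 1, hi⟩ n) (fun _ => rfl)
    (fun n => by simp only [PertIndex.stage]; lia) (V := ξ.model j (i + 1)) (fun _ => rfl)
    (fun n => (hξ.law_model j hj _ hi.1 hi.2 n).identDistrib (hξ.law_model j hj _ hi.1 hi.2 0))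
    h1 h2
  exact hξ.isIID_of_past hj h3 h4

end Perturbations.IsSampleOf

end Reference


/-! ### Induction over times and over iterations -/

variable {m : ℕ} {d : ℕ → ℕ} {Ω : Type*} [MeasurableSpace Ω] {P : Measure Ω}

/-- Gaussian moments of all orders are finite, and the common law makes the bounds uniform in the
member. Both ensembles use the same perturbations, so the difference is zero. -/
theorem lpConv_of_hasLaw_gaussian {V : Type*} [NormedAddCommGroup V] [NormedSpace ℝ V]
    [CompleteSpace V] [SecondCountableTopology V] [MeasurableSpace V] [BorelSpace V]
    {μ : Measure V} [IsGaussian μ] {v : ℕ → Ω → V} (hv : ∀ n, HasLaw (v n) μ P) {ι : Type*}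
    {G : Filter ι} (u : ι → ℕ) : LpConv P G (fun i => v (u i)) (fun i => v (u i)) := by
  refine LpConv.refl (fun i => (hv _).aemeasurable.aestronglyMeasurable) fun p hp hp' =>
    ⟨eLpNorm id p μ, (IsGaussian.memLp_id μ p hp').eLpNorm_ne_top, fun i => ?_⟩
  rw [← (hv (u i)).map_eq, eLpNorm_map_measure aestronglyMeasurable_id (hv (u i)).aemeasurable]
  rfl

variable [IsProbabilityMeasure P] {D : Problem m d} {ξ : Perturbations Ω m d}

open scoped Matrix.Norms.L2Operator in
/-- Within one LM iteration, the EnKS ensemble approaches the reference ensemble in `L^p`,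
uniformly over the members, when the linearization points converge in `L^p`. -/
theorem lpConv_enks (hD : D.Admissible) (hg : D.PolynomialGrowth) (hξ : ξ.IsSampleOf D P) {j : ℕ}
    (hj : 1 ≤ j) {α : Type*} {F : Filter α} {N : α → ℕ} (hN : Tendsto N F atTop)
    {Z : α → Ω → ℕ → State m} {z : ℕ → State m}
    (hZ : ∀ l, LpConv P F (fun a ω => Z a ω l) (fun _ _ => z l)) {i : ℕ} (hik : i ≤ D.k) (l : ℕ) :
    LpConv P (F ×ˢ (⊤ : Filter ℕ))
      (fun q ω => D.enks (N q.1) (Z q.1 ω) (fun n => ξ.init j n ω) (fun i n => ξ.model j i n ω)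
        (fun i n => ξ.obs j i n ω) i q.2 l)
      (fun q ω => D.refEnks P z (ξ.init j) (ξ.model j) (ξ.obs j) i q.2 ω l) := by
  rcases isEmpty_or_nonempty α with hα | ⟨⟨a₀⟩⟩
  · exact ⟨fun q => isEmptyElim q.1, fun q => isEmptyElim q.1,
      fun p _ _ => ⟨0, by simp, fun q => isEmptyElim q.1⟩,
      fun p _ _ => by rw [Subsingleton.elim (F ×ˢ (⊤ : Filter ℕ)) ⊥]; exact tendsto_bot⟩
  induction i generalizing l with
  | zero =>
    simp only [Problem.enks, Problem.refEnks, initial]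
    by_cases hl : l = 0
    · subst hl
      simp only [Pi.single_eq_same]
      exact lpConv_of_hasLaw_gaussian (hξ.law_init j hj) Prod.snd
    · simp only [Pi.single_eq_of_ne hl]
      exact LpConv.const 0
  | succ i ih =>
    have hi : 1 ≤ i + 1 := by lia
    have hZ' : ∀ l, LpConv P (F ×ˢ (⊤ : Filter ℕ)) (fun q ω => Z q.1 ω l) (fun _ _ => z l) :=
      fun l => (hZ l).comp_tendsto tendsto_fst
    have hf := lpConv_forecast hg hik (hZ' i) (ih (by lia))
      (lpConv_of_hasLaw_gaussian (hξ.law_model j hj (i + 1) hi hik) Prod.snd)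
    have hiid := hξ.isIID_forecast_refEnks hj z hik
    have hC := lpConv_sampleCov (f := fun a n ω => D.forecast (Z a ω) i
      (D.enks (N a) (Z a ω) (fun n => ξ.init j n ω) (fun i n => ξ.model j i n ω)
        (fun i n => ξ.obs j i n ω) i n) (ξ.model j (i + 1) n ω)) hiid hf hN (i + 1)
    -- The gain is common to all members, so it converges along `F` alone; below it is pulled back
    -- to the product filter.
    have hK := lpConv_gain hD hg hi hik (hZ (i + 1)) hC
      (fun a ω => posSemidef_sampleCov _ _ _)
      (posSemidef_crossCov ((hf (i + 1)).memLp_right one_le_two (by simp) (a₀, 0)))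
    exact lpConv_analysis hg hi hik (hZ' (i + 1)) (fun l => (hK l).comp_tendsto tendsto_fst) hf
      (lpConv_of_hasLaw_gaussian (hξ.law_obs j hj (i + 1) hi hik) Prod.snd) l

theorem minSizesAtTop_anti {j j' : ℕ} (h : j ≤ j') : minSizesAtTop j' ≤ minSizesAtTop j :=
  iInf_mono fun _ => principal_mono.2 fun _ hN l hl hlj => hN l hl (hlj.trans h)

theorem tendsto_size_minSizesAtTop {j l : ℕ} (hl : 1 ≤ l) (hlj : l ≤ j) :
    Tendsto (fun N : ℕ → ℕ => N l) (minSizesAtTop j) atTop :=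
  tendsto_atTop.2 fun c => mem_iInf_of_mem c fun _ hN => hN l hl hlj

/-- Convergence of the iterates and, uniformly over the members, of the ensembles. -/
theorem lpConv_iterate_member (hD : D.Admissible) (hg : D.PolynomialGrowth)
    (hξ : ξ.IsSampleOf D P) (j : ℕ) :
    (∀ l, LpConv P (minSizesAtTop j) (fun N ω => D.iterate ξ N j ω l)
      (fun _ _ => ∫ ω, D.refMember P ξ j 0 ω l ∂P)) ∧
    ∀ l, LpConv P (minSizesAtTop j ×ˢ (⊤ : Filter ℕ)) (fun q ω => D.member ξ q.1 j q.2 ω l)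
      (fun q ω => D.refMember P ξ j q.2 ω l) := by
  induction j with
  | zero =>
    simp only [Problem.iterate, Problem.member, Problem.refMember, integral_const, probReal_univ,
      one_smul]
    exact ⟨fun l => LpConv.const _, fun l => LpConv.const _⟩
  | succ j ih =>
    have hN := tendsto_size_minSizesAtTop (j := j + 1) (l := j + 1) (by lia) le_rfl
    have hm := fun l => lpConv_enks (l := l) hD hg hξ (j := j + 1) (by lia) hN
      (fun l => (ih.1 l).comp_tendsto (minSizesAtTop_anti (Nat.le_succ j))) (le_refl D.k)
    refine ⟨fun l => ?_, hm⟩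
    -- The iterate is the sample mean of the ensemble controlled by `hm`, so its limit is the mean
    -- of reference member `0`, the next linearization point.
    have := lpConv_sampleMean_of_isIID (hξ.isIID_refEnks (j := j + 1) (by lia)
      (fun i => ∫ ω, D.refMember P ξ j 0 ω i ∂P) le_rfl) (f := fun N n ω =>
        D.lmStep ξ (j + 1) (N (j + 1)) (D.iterate ξ N j ω) ω n l) (u := fun x => x l)
      (by rw [← BorelSpace.measurable_eq]; fun_prop) (hm l) hN
    simp only [Problem.iterate, sampleMean, Pi.smul_apply, Finset.sum_apply] at this ⊢
    exact this

/-! ### From single times to composite states -/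

omit [IsProbabilityMeasure P] in
theorem LpConv.finset_sum {ι κ V : Type*} [NormedAddCommGroup V] {G : Filter ι} (s : Finset κ)
    {X Y : κ → ι → Ω → V} (hs : s.Nonempty) (h : ∀ l, LpConv P G (X l) (Y l)) :
    LpConv P G (fun i ω => ∑ l ∈ s, X l i ω) (fun i ω => ∑ l ∈ s, Y l i ω) := by
  induction hs using Finset.Nonempty.cons_induction with
  | singleton l => simpa using h l
  | cons l s hl hs ih => simpa only [Finset.sum_cons] using (h l).add ih

-- A composite state is the finite sum of its entries under continuous linear embeddings, so
-- convergence at each time suffices.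
omit [IsProbabilityMeasure P] in
theorem LpConv.composite {ι : Type*} {G : Filter ι} {X Y : ι → Ω → ℕ → State m}
    (h : ∀ l, LpConv P G (fun a ω => X a ω l) (fun a ω => Y a ω l)) (k : ℕ) :
    LpConv P G (fun a ω => composite k (X a ω)) (fun a ω => composite k (Y a ω)) := by
  have e : ∀ x : ℕ → State m, LMEnKS.composite k x = ∑ l : Fin (k + 1),
      ((PiLp.continuousLinearEquiv 2 ℝ fun _ : Fin (k + 1) => State m).symm.toContinuousLinearMap ∘L
        ContinuousLinearMap.single ℝ (fun _ : Fin (k + 1) => State m) l) (x l) := by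
    intro x
    simp only [ContinuousLinearMap.comp_apply]
    rw [← map_sum]
    simp [LMEnKS.composite, Finset.univ_sum_single (fun l : Fin (k + 1) => x l)]
  simp only [e]
  exact LpConv.finset_sum _ Finset.univ_nonempty fun l => (h l).clm _

omit [IsProbabilityMeasure P] in
theorem integral_composite {k : ℕ} {X : Ω → ℕ → State m}
    (h : Integrable (fun ω => composite k (X ω)) P) :
    ∫ ω, composite k (X ω) ∂P = composite k fun l => ∫ ω, X ω l ∂P := by
  ext1 l
  exact ((PiLp.proj 2 (𝕜 := ℝ) (fun _ : Fin (k + 1) => State m) l).integral_comp_comm h).symm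

omit [IsProbabilityMeasure P] in
theorem LpConv.tendstoLp {ι V : Type*} [NormedAddCommGroup V] {G : Filter ι} [Nonempty ι]
    {X : ι → Ω → V} {Y : Ω → V} (h : LpConv P G X fun _ => Y) {p : ℝ≥0∞} (hp : 1 ≤ p)
    (hp' : p ≠ ∞) : TendstoLp P p G X Y :=
  ⟨h.memLp_right hp hp' (Classical.arbitrary ι), h.eventually_memLp_left hp hp', h.lim p hp hp'⟩

end LMEnKS

theorem mainTheorem2 {Ω : Type*} [MeasurableSpace Ω] (P : Measure Ω) [IsProbabilityMeasure P]
    {m : ℕ} {d : ℕ → ℕ} (D : LMEnKS.Problem m d) (ξ : LMEnKS.Perturbations Ω m d)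
    (hD : D.Admissible) (hgrowth : D.PolynomialGrowth) (hξ : ξ.IsSampleOf D P)
    (j : ℕ) (p : ℝ≥0∞) (hp : 1 ≤ p) (hp' : p ≠ ∞) :
    (∀ n : ℕ, LMEnKS.TendstoLp P p (LMEnKS.minSizesAtTop j)
      (fun N ω => LMEnKS.composite D.k (D.member ξ N j n ω))
      (fun ω => LMEnKS.composite D.k (D.refMember P ξ j n ω))) ∧
    LMEnKS.TendstoLp P p (LMEnKS.minSizesAtTop j)
      (fun N ω => LMEnKS.composite D.k (D.iterate ξ N j ω))
      (fun _ => ∫ ω, LMEnKS.composite D.k (D.refMember P ξ j 0 ω) ∂P) := by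
  have h := LMEnKS.lpConv_iterate_member hD hgrowth hξ j
  -- Uniform convergence over members is restricted to a fixed `n` along `N ↦ (N, n)`.
  have hm : ∀ n l, LMEnKS.LpConv P (LMEnKS.minSizesAtTop j) (fun N ω => D.member ξ N j n ω l)
      (fun _ ω => D.refMember P ξ j n ω l) := fun n l =>
    (h.2 l).comp_tendsto (u := fun N => (N, n)) (tendsto_id.prodMk tendsto_top)
  have hc := fun n => LMEnKS.LpConv.composite (hm n) D.k
  refine ⟨fun n => (hc n).tendstoLp hp hp', ?_⟩
  rw [LMEnKS.integral_composite
    (((hc 0).memLp_right le_rfl (by simp) (fun _ => 0)).integrable le_rfl)]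
  exact (LMEnKS.LpConv.composite h.1 D.k).tendstoLp hp hp'
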